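/- Let $d\ge 1$ be an integer and $\alpha>-1/2$. Write $m_\alpha(x)=(1-|x|^2)_+^\alpha$ for $x\in\mathbb R^d$ (equal to $0$ for $|x|\ge 1$), $\widehat\varphi(\xi)=\int_{\mathbb R^d}\varphi(t)e^{-2i\pi\langle t,\xi\rangle}\,dt$ for the Fourier transform, and $|\varphi|^*(x)=\int_0^\infty\chi_{\{|\varphi|>t\}^*}(x)\,dt$ for the symmetric decreasing rearrangement of $\varphi$, where $E^*$ is the open ball centred at $0$ with $|E^*|=|E|$. The support of $\varphi$ is understood, up to null sets, as $\{\varphi\ne 0\}$. Call $\vartheta>0$ a Donoho--Stark constant for $(d,\alpha)$ if, for all $\Omega,S>0$ with $\Omega S^{1/d}\le\vartheta$ and all $\varphi\in L^1(\mathbb R^d)$ with support of measure at most $S$, $$\left|\int_{\mathbb R^d}\Omega^{-d}m_\alpha(\xi/\Omega)\,\widehat\varphi(\xi)\,d\xi\right|\le\int_{\mathbb R^d}\Omega^{-d}m_\alpha(\xi/\Omega)\,\widehat{|\varphi|^*}(\xi)\,d\xi .$$ Then a Donoho--Stark constant for $(d,\alpha)$ exists. Moreover, let $\vartheta=\vartheta(d,\alpha)$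 be any such constant, let $\Omega>0$, and let $\varphi\in L^2(\mathbb R^d)$ have support of finite measure $S$ with $\Omega S^{1/d}\le\vartheta/2$. Then $|\varphi|^*\in L^1(\mathbb R^d)$, both integrals below converge absolutely, and $$\left|\int_{\mathbb R^d}\Omega^{-d}m_\alpha(\xi/\Omega)\,|\widehat\varphi(\xi)|^2\,d\xi\right|\le\int_{\mathbb R^d}\Omega^{-d}m_\alpha(\xi/\Omega)\,\bigl|\widehat{|\varphi|^*}(\xi)\bigr|^2\,d\xi .$$ -/

import Mathlib

open MeasureTheory
open scoped ENNReal FourierTransform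

noncomputable section

/-- The Bochner-Riesz multiplier `m_α(x) = (1 - |x|²)₊^α` on `ℝᵈ`. It is set to `0` outside the open
unit ball for every `α` (so that `m_0` is the characteristic function of the unit ball). -/
def bochnerRiesz (d : ℕ) (α : ℝ) (x : EuclideanSpace ℝ (Fin d)) : ℝ :=
  if ‖x‖ < 1 then (1 - ‖x‖ ^ 2) ^ α else 0

/-- The rescaled weight `Ω^{-d} m_α(ξ / Ω)`. -/
def bochnerRieszWeight (d : ℕ) (α Ω : ℝ) (ξ : EuclideanSpace ℝ (Fin d)) : ℝ :=
  (Ω ^ d)⁻¹ * bochnerRiesz d α (Ω⁻¹ • ξ)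

/-- The symmetric rearrangement `E^*` of a set `E ⊆ ℝᵈ` of finite measure: the open ball `B(0, r)`
with `|B(0, 1)| r^d = |E|`. -/
def symmRearrSet {d : ℕ} (E : Set (EuclideanSpace ℝ (Fin d))) : Set (EuclideanSpace ℝ (Fin d)) :=
  Metric.ball 0
    ((volume E / volume (Metric.ball (0 : EuclideanSpace ℝ (Fin d)) 1)).toReal ^ (1 / (d : ℝ)))

/-- The symmetric rearrangement `|φ|^*` of a function `φ` vanishing at infinity, through the
layer-cake formula `|φ|^*(x) = ∫₀^∞ χ_{{|φ| > t}^*}(x) dt`. (If `φ` is essentially unbounded, the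
integral is `+∞` at the single point `x = 0`, where the function is then given the value `0`.) -/
def symmRearr {d : ℕ} (φ : EuclideanSpace ℝ (Fin d) → ℂ) (x : EuclideanSpace ℝ (Fin d)) : ℝ :=
  (∫⁻ t in Set.Ioi (0 : ℝ),
    (symmRearrSet {y | t < ‖φ y‖}).indicator (fun _ => (1 : ℝ≥0∞)) x).toReal

/-- `ϑ` is a constant for the `L¹` Donoho-Stark inequality in dimension `d` with exponent `α`:
`ϑ > 0` and, whenever `Ω S^{1/d} ≤ ϑ` and `φ ∈ L¹(ℝᵈ)` has support of measure at most `S`,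
`|∫ Ω^{-d} m_α(ξ/Ω) φ̂(ξ) dξ| ≤ ∫ Ω^{-d} m_α(ξ/Ω) (|φ|^*)^(ξ) dξ`.
The right-hand integral is real because `|φ|^*` is real and even; hence the real part. -/
def IsDonohoStarkConstant (d : ℕ) (α ϑ : ℝ) : Prop :=
  0 < ϑ ∧
  ∀ Ω S : ℝ, 0 < Ω → 0 < S → Ω * S ^ (1 / (d : ℝ)) ≤ ϑ →
  ∀ φ : EuclideanSpace ℝ (Fin d) → ℂ, Integrable φ →
    volume (Function.support φ) ≤ ENNReal.ofReal S →
    ‖∫ ξ, (bochnerRieszWeight d α Ω ξ : ℂ) * 𝓕 φ ξ‖ ≤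
      (∫ ξ, (bochnerRieszWeight d α Ω ξ : ℂ) * 𝓕 (fun x => (symmRearr φ x : ℂ)) ξ).re

end

/-! Let `K` be the Fourier transform of `m_α`: real, radial, continuous, vanishing at infinity. By
Fourier duality the `L¹` inequality compares `∫ K(Ωx) φ(x) dx` with `∫ K(Ωx) |φ|^*(x) dx`. The pivot
is that `ϑ` is a Donoho-Stark constant exactly when `K(t) ≥ |K(s)|` for all `|t| ≤ |s|` with `|t| ≤
ρ`, where `ρ = ϑ / |B(0,1)|^{1/d}` (`RadiallyDominant`).

If this dominance holds, the function `ψ` that agrees with `K` up to radius `ρ` and is frozen beyond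
is a radially nonincreasing majorant of `|K|`; Hardy-Littlewood applies to `ψ`, and `ψ(Ω·) = K(Ω·)`
where `|φ|^*` lives (`RadiallyDominant.isDonohoStarkConstant`). Conversely, moving a small piece of
a ball outwards, with a sign, tests the dominance pointwise
(`IsDonohoStarkConstant.radiallyDominant`). Some `ρ > 0` always works, because `K` has a strict
maximum at `0` and decreases near `0`.

For the quadratic inequality, `∫ w |φ̂|² = ∬ K(Ω(x - y)) φ(x) conj φ(y)` is at most the energy of
`|φ|` with kernel `ψ(Ω·)`, which Riesz' inequality `rieszEnergy_le_symmRearr` bounds by that of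
`|φ|^*`. Differences of points of the ball carrying `|φ|^*` have at most twice its radius, so under
`ΩS^{1/d} ≤ ϑ/2` the majorant `ψ` can be replaced by `K` again.

Riesz' inequality is obtained by polarization: reflecting larger values to one side of a hyperplane
does not decrease the energy. Among equimeasurable functions of no smaller energy in an
Arzelà-Ascoli class, one of least second moment must be radially nonincreasing. Density and the `L¹`
contraction property of rearrangement give the general case. -/

/-! ### Positivity and integrability of the multiplier. -/

theorem bochnerRiesz_nonneg (d : ℕ) (α : ℝ) (x : EuclideanSpace ℝ (Fin d)) :
    0 ≤ bochnerRiesz d α x := by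
  unfold bochnerRiesz
  split_ifs with h
  · exact Real.rpow_nonneg (by nlinarith [norm_nonneg x]) _
  · exact le_rfl

theorem bochnerRiesz_pos {d : ℕ} {α : ℝ} {x : EuclideanSpace ℝ (Fin d)} (h : ‖x‖ < 1) :
    0 < bochnerRiesz d α x := by
  rw [bochnerRiesz, if_pos h]
  exact Real.rpow_pos_of_pos (by nlinarith [norm_nonneg x]) _

/-- In polar coordinates `(1 - r²)^α = (1 + r)^α (1 - r)^α`; the first factor is bounded on `(0, 1)`
and the second is integrable at `r = 1` since `α > -1`. -/
theorem integrable_bochnerRiesz {d : ℕ} (hd : 1 ≤ d) {α : ℝ} (hα : -1 < α) :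
    Integrable (bochnerRiesz d α) := by
  have : Nonempty (Fin d) := ⟨⟨0, hd⟩⟩
  have key := integrable_fun_norm_addHaar (volume : Measure (EuclideanSpace ℝ (Fin d)))
    (f := fun r : ℝ => if r < 1 then (1 - r ^ 2) ^ α else 0)
  refine key.2 ?_
  have h1 : IntegrableOn (fun r : ℝ => (1 - r) ^ α) (Set.Ioo 0 1) := by
    have h := (intervalIntegral.intervalIntegrable_rpow' (a := 0) (b := 1) hα).comp_sub_left 1
    simp only [sub_zero, sub_self] at h
    have h' := h.symm
    rw [intervalIntegrable_iff_integrableOn_Ioo_of_le zero_le_one] at h'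
    exact h'
  have h2 : IntegrableOn (fun r : ℝ => (r ^ (Module.finrank ℝ (EuclideanSpace ℝ (Fin d)) - 1)
      * (1 + r) ^ α) * (1 - r) ^ α) (Set.Ioo 0 1) := by
    refine Integrable.bdd_mul (c := 2 ^ |α|) h1 ?_ ?_
    · exact (by fun_prop : Measurable _).aestronglyMeasurable
    · refine (ae_restrict_iff' measurableSet_Ioo).2 (ae_of_all _ fun r hr => ?_)
      have hr1 : (0 : ℝ) ≤ r := hr.1.le
      rw [norm_mul, norm_pow, Real.norm_of_nonneg hr1,
        Real.norm_of_nonneg (Real.rpow_nonneg (by linarith) _)]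
      have a1 : r ^ (Module.finrank ℝ (EuclideanSpace ℝ (Fin d)) - 1) ≤ 1 :=
        pow_le_one₀ hr1 hr.2.le
      have a2 : (1 + r) ^ α ≤ 2 ^ |α| :=
        (Real.rpow_le_rpow_of_exponent_le (by linarith) (le_abs_self α)).trans
          (Real.rpow_le_rpow (by linarith) (by linarith [hr.2]) (abs_nonneg α))
      calc _ ≤ 1 * (2 : ℝ) ^ |α| := by gcongr
        _ = _ := one_mul _
  have h3 : Set.Ioi (0 : ℝ) = Set.Ioo 0 1 ∪ Set.Ici 1 := by
    rw [Set.Ioo_union_Ici_eq_Ioi zero_lt_one]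
  rw [h3]
  refine IntegrableOn.union ?_ ?_
  · refine h2.congr_fun (fun r hr => ?_) measurableSet_Ioo
    have : (1 - r ^ 2) = (1 + r) * (1 - r) := by ring
    simp only [smul_eq_mul, if_pos hr.2]
    rw [this, Real.mul_rpow (by linarith [hr.1]) (by linarith [hr.2]), mul_assoc]
  · refine IntegrableOn.congr_fun integrableOn_zero (fun r hr => ?_) measurableSet_Ici
    simp [not_lt.2 (Set.mem_Ici.1 hr)]

/-! ### The kernel: continuity, decay, symmetry, and behaviour near the origin. -/

/-- The Fourier transform of the Bochner-Riesz multiplier, as a real cosine integral. -/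
noncomputable def bochnerRieszKernel (d : ℕ) (α : ℝ) (t : EuclideanSpace ℝ (Fin d)) : ℝ :=
  ∫ x, bochnerRiesz d α x * Real.cos (2 * Real.pi * inner ℝ x t)

section Kernel

variable {d : ℕ} {α : ℝ}

theorem integrable_bochnerRiesz_mul_cos (hd : 1 ≤ d) (hα : -1 < α)
    (t : EuclideanSpace ℝ (Fin d)) :
    Integrable fun x => bochnerRiesz d α x * Real.cos (2 * Real.pi * inner ℝ x t) :=
  (integrable_bochnerRiesz hd hα).mul_bdd (c := 1)
    (by fun_prop : Continuous _).aestronglyMeasurable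
    (ae_of_all _ fun x => by simpa using Real.abs_cos_le_one _)

theorem fourier_bochnerRiesz (hd : 1 ≤ d) (hα : -1 < α) (t : EuclideanSpace ℝ (Fin d)) :
    𝓕 (fun x => (bochnerRiesz d α x : ℂ)) t = bochnerRieszKernel d α t := by
  rw [Real.fourier_eq']
  have h : ∀ v : EuclideanSpace ℝ (Fin d),
      Complex.exp (↑(-2 * Real.pi * inner ℝ v t) * Complex.I) • (bochnerRiesz d α v : ℂ) =
      ((bochnerRiesz d α v * Real.cos (2 * Real.pi * inner ℝ v t) : ℝ) : ℂ) -
      ((bochnerRiesz d α v * Real.sin (2 * Real.pi * inner ℝ v t) : ℝ) : ℂ) * Complex.I := by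
    intro v
    rw [Complex.exp_mul_I, ← Complex.ofReal_cos, ← Complex.ofReal_sin,
      show -2 * Real.pi * inner ℝ v t = -(2 * Real.pi * inner ℝ v t) by ring,
      Real.cos_neg, Real.sin_neg, smul_eq_mul]
    push_cast
    ring
  have hs : Integrable fun x : EuclideanSpace ℝ (Fin d) =>
      bochnerRiesz d α x * Real.sin (2 * Real.pi * inner ℝ x t) :=
    (integrable_bochnerRiesz hd hα).mul_bdd (c := 1)
      (by fun_prop : Continuous _).aestronglyMeasurable
      (ae_of_all _ fun x => by simpa using Real.abs_sin_le_one _)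
  have hodd : ∫ x : EuclideanSpace ℝ (Fin d),
      bochnerRiesz d α x * Real.sin (2 * Real.pi * inner ℝ x t) = 0 := by
    have := integral_neg_eq_self (fun x : EuclideanSpace ℝ (Fin d) =>
      bochnerRiesz d α x * Real.sin (2 * Real.pi * inner ℝ x t)) volume
    simp only [bochnerRiesz, norm_neg, inner_neg_left, mul_neg, Real.sin_neg,
      integral_neg] at this
    simp only [bochnerRiesz]
    linarith
  simp_rw [h]
  rw [integral_sub (integrable_bochnerRiesz_mul_cos hd hα t).ofReal
    (hs.ofReal.mul_const _), integral_mul_const, integral_complex_ofReal, integral_complex_ofReal, hodd]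
  simp [bochnerRieszKernel]

theorem continuous_bochnerRieszKernel (hd : 1 ≤ d) (hα : -1 < α) :
    Continuous (bochnerRieszKernel d α) := by
  have h : Continuous (𝓕 (fun x => (bochnerRiesz d α x : ℂ))) :=
    VectorFourier.fourierIntegral_continuous Real.continuous_fourierChar
      (by exact continuous_inner) (integrable_bochnerRiesz hd hα).ofReal
  have : bochnerRieszKernel d α = fun t => (𝓕 (fun x => (bochnerRiesz d α x : ℂ)) t).re := by
    funext t; rw [fourier_bochnerRiesz hd hα, Complex.ofReal_re]
  rw [this]
  exact Complex.continuous_re.comp h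

theorem tendsto_bochnerRieszKernel (hd : 1 ≤ d) (hα : -1 < α) :
    Filter.Tendsto (bochnerRieszKernel d α) (Filter.cocompact _) (nhds 0) := by
  have h : Filter.Tendsto (𝓕 (fun x => (bochnerRiesz d α x : ℂ))) (Filter.cocompact _) (nhds 0) :=
    tendsto_integral_exp_inner_smul_cocompact _
  have : bochnerRieszKernel d α = fun t => (𝓕 (fun x => (bochnerRiesz d α x : ℂ)) t).re := by
    funext t; rw [fourier_bochnerRiesz hd hα, Complex.ofReal_re]
  rw [this]
  exact (Complex.continuous_re.tendsto 0).comp h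

/-- The reflection exchanging `s` and `t` preserves the multiplier and commutes with the Fourier
transform. -/
theorem bochnerRieszKernel_eq_of_norm_eq (hd : 1 ≤ d) (hα : -1 < α)
    {s t : EuclideanSpace ℝ (Fin d)} (h : ‖s‖ = ‖t‖) :
    bochnerRieszKernel d α s = bochnerRieszKernel d α t := by
  have h1 := Real.fourier_comp_linearIsometry ((ℝ ∙ (s - t))ᗮ.reflection)
    (fun x => (bochnerRiesz d α x : ℂ)) s
  rw [Submodule.reflection_sub h] at h1
  have h2 : (fun x => (bochnerRiesz d α x : ℂ)) ∘ ((ℝ ∙ (s - t))ᗮ.reflection) =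
      fun x => (bochnerRiesz d α x : ℂ) := by
    funext x; simp [bochnerRiesz]
  rw [h2, fourier_bochnerRiesz hd hα, fourier_bochnerRiesz hd hα] at h1
  exact_mod_cast h1

theorem exists_norm_eq_of_nonneg (hd : 1 ≤ d) {r : ℝ} (hr : 0 ≤ r) :
    ∃ x : EuclideanSpace ℝ (Fin d), ‖x‖ = r := by
  exact ⟨EuclideanSpace.single ⟨0, hd⟩ r, by simp [abs_of_nonneg hr]⟩

/-- Radiality puts both points on one ray. For `‖x‖ < 1` and norms at most `1/2` the phases have
absolute value at most `π`, where the cosine decreases, so the integrands compare pointwise. -/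
theorem bochnerRieszKernel_anti (hd : 1 ≤ d) (hα : -1 < α)
    {s t : EuclideanSpace ℝ (Fin d)} (h : ‖t‖ ≤ ‖s‖) (hs : ‖s‖ ≤ 1 / 2) :
    bochnerRieszKernel d α s ≤ bochnerRieszKernel d α t := by
  obtain ⟨e, he⟩ := exists_norm_eq_of_nonneg hd zero_le_one
  rw [bochnerRieszKernel_eq_of_norm_eq hd hα (s := s) (t := ‖s‖ • e) (by simp [norm_smul, he]),
    bochnerRieszKernel_eq_of_norm_eq hd hα (s := t) (t := ‖t‖ • e) (by simp [norm_smul, he])]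
  refine integral_mono (integrable_bochnerRiesz_mul_cos hd hα _)
    (integrable_bochnerRiesz_mul_cos hd hα _) fun x => ?_
  rcases lt_or_ge ‖x‖ 1 with hx | hx
  · refine mul_le_mul_of_nonneg_left ?_ (bochnerRiesz_nonneg d α x)
    have hp : |(inner ℝ x e : ℝ)| ≤ 1 := by
      have := abs_real_inner_le_norm x e
      rw [he, mul_one] at this
      linarith
    rw [← Real.cos_abs, ← Real.cos_abs (2 * Real.pi * inner ℝ x (‖t‖ • e))]
    simp only [inner_smul_right, abs_mul, abs_norm, abs_of_pos Real.pi_pos, abs_two]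
    have := abs_nonneg (inner ℝ x e : ℝ)
    have hpi := Real.pi_pos
    refine Real.cos_le_cos_of_nonneg_of_le_pi (by positivity) ?_ (by gcongr)
    calc 2 * Real.pi * (‖s‖ * |(inner ℝ x e : ℝ)|) ≤ 2 * Real.pi * (1 / 2 * 1) := by gcongr
      _ = Real.pi := by ring
  · simp [bochnerRiesz, not_lt.2 hx]

theorem bochnerRieszKernel_zero (d : ℕ) (α : ℝ) :
    bochnerRieszKernel d α 0 = ∫ x, bochnerRiesz d α x := by
  simp [bochnerRieszKernel]

theorem integral_bochnerRiesz_mul_pos {g : EuclideanSpace ℝ (Fin d) → ℝ}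
    (hg : Continuous g) (hg0 : 0 ≤ g) (hi : Integrable fun x => bochnerRiesz d α x * g x)
    {x₀ : EuclideanSpace ℝ (Fin d)} (hx₀ : ‖x₀‖ < 1) (hgx : g x₀ ≠ 0) :
    0 < ∫ x, bochnerRiesz d α x * g x := by
  rw [integral_pos_iff_support_of_nonneg
    (fun x => mul_nonneg (bochnerRiesz_nonneg d α x) (hg0 x)) hi]
  have ho : IsOpen {x : EuclideanSpace ℝ (Fin d) | ‖x‖ < 1 ∧ g x ≠ 0} :=
    (isOpen_lt continuous_norm continuous_const).inter (isOpen_ne_fun hg continuous_const)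
  refine (ho.measure_pos volume ⟨x₀, hx₀, hgx⟩).trans_le (measure_mono fun x hx => ?_)
  exact mul_ne_zero (bochnerRiesz_pos hx.1).ne' hx.2

/-- `K(0) ± K(t)` is the integral of `m_α` against `1 ± cos`, a nonnegative continuous function that
is nonzero somewhere in the unit ball. -/
theorem abs_bochnerRieszKernel_lt (hd : 1 ≤ d) (hα : -1 < α)
    {t : EuclideanSpace ℝ (Fin d)} (ht : t ≠ 0) :
    |bochnerRieszKernel d α t| < bochnerRieszKernel d α 0 := by
  have hm := integrable_bochnerRiesz hd hα
  have hc := integrable_bochnerRiesz_mul_cos hd hα t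
  have hn : 0 < ‖t‖ := norm_pos_iff.2 ht
  -- Chosen so that `η • t` lies in the unit ball and its phase `2πη‖t‖²` lies in `(0, π)`: the sine
  -- is then nonzero, which excludes both `cos = 1` and `cos = -1` at this one point.
  set η : ℝ := 1 / (2 * (1 + ‖t‖) ^ 2) with hη
  have hη0 : 0 < η := by positivity
  have h1 : ‖η • t‖ < 1 := by
    rw [norm_smul, Real.norm_of_nonneg hη0.le, hη, div_mul_eq_mul_div, div_lt_one (by positivity)]
    nlinarith
  have h2 : Real.sin (2 * Real.pi * inner ℝ (η • t) t) ≠ 0 := by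
    rw [real_inner_smul_left, real_inner_self_eq_norm_sq]
    have h3 : 2 * (η * ‖t‖ ^ 2) < 1 := by
      rw [hη, div_mul_eq_mul_div, ← mul_div_assoc, div_lt_one (by positivity)]
      nlinarith
    refine (Real.sin_pos_of_pos_of_lt_pi (by positivity) ?_).ne'
    nlinarith [Real.pi_pos]
  have hsq := Real.sin_sq_add_cos_sq (2 * Real.pi * inner ℝ (η • t) t)
  have h2' := pow_ne_zero 2 h2
  rw [abs_lt, bochnerRieszKernel_zero]
  constructor
  · have := integral_bochnerRiesz_mul_pos (d := d) (α := α)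
      (g := fun x => 1 + Real.cos (2 * Real.pi * inner ℝ x t)) (by fun_prop)
      (fun x => by simpa using by linarith [Real.neg_one_le_cos (2 * Real.pi * inner ℝ x t)])
      (by simp only [mul_add, mul_one]; exact hm.add hc) h1
      (fun h => h2' (by rw [show Real.cos (2 * Real.pi * inner ℝ (η • t) t) = -1 by linarith] at hsq
                        linarith))
    simp only [mul_add, mul_one] at this
    rw [integral_add hm hc] at this
    unfold bochnerRieszKernel
    linarith
  · have := integral_bochnerRiesz_mul_pos (d := d) (α := α)
      (g := fun x => 1 - Real.cos (2 * Real.pi * inner ℝ x t)) (by fun_prop)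
      (fun x => by simpa using by linarith [Real.cos_le_one (2 * Real.pi * inner ℝ x t)])
      (by simp only [mul_sub, mul_one]; exact hm.sub hc) h1
      (fun h => h2' (by rw [show Real.cos (2 * Real.pi * inner ℝ (η • t) t) = 1 by linarith] at hsq
                        linarith))
    simp only [mul_sub, mul_one] at this
    rw [integral_sub hm hc] at this
    unfold bochnerRieszKernel
    linarith

theorem bochnerRieszKernel_zero_pos (hd : 1 ≤ d) (hα : -1 < α) :
    0 < bochnerRieszKernel d α 0 := by
  obtain ⟨e, he⟩ := exists_norm_eq_of_nonneg hd zero_le_one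
  exact (abs_nonneg _).trans_lt
    (abs_bochnerRieszKernel_lt hd hα (t := e) (norm_pos_iff.1 (by rw [he]; exact one_pos)))

end Kernel

/-! ### Radial dominance of the kernel near the origin. -/

/-- Within radius `ρ` the values of `k` dominate the absolute values of `k` further out. -/
def RadiallyDominant {E : Type*} [Norm E] (k : E → ℝ) (ρ : ℝ) : Prop :=
  ∀ t s : E, ‖t‖ ≤ ‖s‖ → ‖t‖ ≤ ρ → |k s| ≤ k t

/-- Decay and compactness give `|K| ≤ c < K(0)` outside radius `1/2`, while `K ≥ c` near `0`. For
`‖s‖ ≤ 1/2` monotonicity gives the upper bound, and the lower bound `-c` by comparison with the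
sphere of radius `1/2`. -/
theorem exists_radiallyDominant_bochnerRieszKernel {d : ℕ} (hd : 1 ≤ d) {α : ℝ} (hα : -1 < α) :
    ∃ ρ > 0, RadiallyDominant (bochnerRieszKernel d α) ρ := by
  have hk := continuous_bochnerRieszKernel hd hα
  have hk0 := bochnerRieszKernel_zero_pos hd hα
  obtain ⟨c, hc0, hc⟩ : ∃ c < bochnerRieszKernel d α 0, ∀ s : EuclideanSpace ℝ (Fin d),
      1 / 2 ≤ ‖s‖ → |bochnerRieszKernel d α s| ≤ c := by
    have hev := (tendsto_bochnerRieszKernel hd hα).abs.eventually_le_const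
      (u := bochnerRieszKernel d α 0 / 2) (by simpa using hk0)
    obtain ⟨K, hK, hKs⟩ := Filter.mem_cocompact.1 hev
    have hA : IsCompact (K ∩ {s : EuclideanSpace ℝ (Fin d) | 1 / 2 ≤ ‖s‖}) :=
      hK.inter_right (isClosed_le continuous_const continuous_norm)
    rcases (K ∩ {s : EuclideanSpace ℝ (Fin d) | 1 / 2 ≤ ‖s‖}).eq_empty_or_nonempty with h | h
    · refine ⟨_, half_lt_self hk0, fun s hs => hKs fun hsK => ?_⟩
      have : s ∈ K ∩ {s : EuclideanSpace ℝ (Fin d) | 1 / 2 ≤ ‖s‖} := ⟨hsK, hs⟩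
      rw [h] at this
      exact this
    · obtain ⟨s₀, hs₀, hmax⟩ := hA.exists_isMaxOn h hk.abs.continuousOn
      refine ⟨max (bochnerRieszKernel d α 0 / 2) |bochnerRieszKernel d α s₀|,
        max_lt (half_lt_self hk0) (abs_bochnerRieszKernel_lt hd hα ?_), fun s hs => ?_⟩
      · rintro rfl
        have := hs₀.2
        norm_num at this
      · by_cases hsK : s ∈ K
        · exact (hmax ⟨hsK, hs⟩).trans (le_max_right _ _)
        · exact (hKs hsK).trans (le_max_left _ _)
  obtain ⟨δ, hδ, hball⟩ := Metric.mem_nhds_iff.1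
    (hk.continuousAt.eventually_const_le hc0)
  refine ⟨min (δ / 2) (1 / 2), by positivity, fun t s hts ht => ?_⟩
  have hct : c ≤ bochnerRieszKernel d α t := hball (by
    rw [mem_ball_zero_iff]
    linarith [min_le_left (δ / 2) (1 / 2)])
  rcases le_total (1 / 2) ‖s‖ with hs | hs
  · exact (hc s hs).trans hct
  · obtain ⟨e, he⟩ := exists_norm_eq_of_nonneg hd (by norm_num : (0 : ℝ) ≤ 1 / 2)
    refine abs_le.2 ⟨?_, bochnerRieszKernel_anti hd hα hts hs⟩
    have h1 := bochnerRieszKernel_anti hd hα (α := α) (s := e) (t := s) (by rw [he]; exact hs) he.le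
    have h2 := (abs_le.1 (hc e he.ge)).1
    linarith

/-! ### Layer-cake sums over families of sets. -/

/-- The function `x ↦ ∫₀^∞ χ_{U t}(x) dt` with superlevel sets `U t`. -/
noncomputable def layerSum {E : Type*} (U : ℝ → Set E) (x : E) : ℝ≥0∞ :=
  ∫⁻ t in Set.Ioi (0 : ℝ), (U t).indicator (fun _ => (1 : ℝ≥0∞)) x

section Layers

variable {E : Type*} [MeasurableSpace E] {μ : Measure E} [SFinite μ] {U W : ℝ → Set E}

theorem measurable_indicator_layers (hU : MeasurableSet {p : ℝ × E | p.2 ∈ U p.1}) :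
    Measurable fun p : ℝ × E => (U p.1).indicator (fun _ => (1 : ℝ≥0∞)) p.2 := by
  have : (fun p : ℝ × E => (U p.1).indicator (fun _ => (1 : ℝ≥0∞)) p.2) =
      {p : ℝ × E | p.2 ∈ U p.1}.indicator fun _ => 1 := by
    funext p
    simp [Set.indicator]
  rw [this]
  exact measurable_const.indicator hU

theorem measurableSet_layer (hU : MeasurableSet {p : ℝ × E | p.2 ∈ U p.1}) (t : ℝ) :
    MeasurableSet (U t) :=
  measurable_prodMk_left (x := t) hU

theorem measurable_layerSum (hU : MeasurableSet {p : ℝ × E | p.2 ∈ U p.1}) :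
    Measurable (layerSum U) :=
  ((measurable_indicator_layers hU).comp measurable_swap).lintegral_prod_right'

theorem lintegral_mul_layerSum (hU : MeasurableSet {p : ℝ × E | p.2 ∈ U p.1}) {ψ : E → ℝ≥0∞}
    (hψ : Measurable ψ) :
    ∫⁻ x, ψ x * layerSum U x ∂μ = ∫⁻ t in Set.Ioi (0 : ℝ), ∫⁻ x in U t, ψ x ∂μ := by
  have hm := measurable_indicator_layers hU
  calc ∫⁻ x, ψ x * layerSum U x ∂μ
      = ∫⁻ x, (∫⁻ t in Set.Ioi (0 : ℝ), ψ x * (U t).indicator (fun _ => (1 : ℝ≥0∞)) x) ∂μ := by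
        refine lintegral_congr fun x => ?_
        rw [layerSum, lintegral_const_mul]
        exact hm.comp measurable_prodMk_right
    _ = ∫⁻ t in Set.Ioi (0 : ℝ), (∫⁻ x, ψ x * (U t).indicator (fun _ => (1 : ℝ≥0∞)) x ∂μ) := by
        refine lintegral_lintegral_swap ?_
        exact ((hψ.comp measurable_fst).mul (hm.comp measurable_swap)).aemeasurable
    _ = _ := by
        refine lintegral_congr fun t => ?_
        rw [← lintegral_indicator (measurableSet_layer hU t)]
        refine lintegral_congr fun x => ?_
        by_cases hx : x ∈ U t <;> simp [hx]

theorem lintegral_layerSum (hU : MeasurableSet {p : ℝ × E | p.2 ∈ U p.1}) :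
    ∫⁻ x, layerSum U x ∂μ = ∫⁻ t in Set.Ioi (0 : ℝ), μ (U t) := by
  simpa using lintegral_mul_layerSum (μ := μ) hU (measurable_const (a := (1 : ℝ≥0∞)))

theorem layerSum_le_add
    (hW : MeasurableSet {p : ℝ × E | p.2 ∈ W p.1}) (x : E) :
    layerSum U x ≤ layerSum W x + layerSum (fun t => U t \ W t) x := by
  unfold layerSum
  have hm : Measurable fun t => (W t).indicator (fun _ => (1 : ℝ≥0∞)) x :=
    (measurable_indicator_layers hW).comp measurable_prodMk_right
  rw [← lintegral_add_left hm]
  refine lintegral_mono fun t => ?_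
  by_cases h1 : x ∈ U t <;> by_cases h2 : x ∈ W t <;> simp [h1, h2]

/-- Reduces one-sided `L¹` comparisons of functions to measures of differences of their layers; used
for the contraction property and for identifying radial functions with their rearrangements. -/
theorem lintegral_layerSum_sub_le (hU : MeasurableSet {p : ℝ × E | p.2 ∈ U p.1})
    (hW : MeasurableSet {p : ℝ × E | p.2 ∈ W p.1}) :
    ∫⁻ x, (layerSum U x - layerSum W x) ∂μ ≤ ∫⁻ t in Set.Ioi (0 : ℝ), μ (U t \ W t) := by
  rw [← lintegral_layerSum (U := fun t => U t \ W t) (hU.diff hW)]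
  exact lintegral_mono fun x => tsub_le_iff_left.2 (layerSum_le_add hW x)

theorem measurableSet_superlevel {φ : E → ℂ} (hφ : Measurable φ) :
    MeasurableSet {p : ℝ × E | p.2 ∈ {y | p.1 < ‖φ y‖}} :=
  measurableSet_lt measurable_fst (hφ.norm.comp measurable_snd)

end Layers

theorem layerSum_superlevel {E : Type*} (φ : E → ℂ) (x : E) :
    layerSum (fun t => {y | t < ‖φ y‖}) x = ‖φ x‖ₑ := by
  have h : ∀ t : ℝ, ({y | t < ‖φ y‖} : Set E).indicator (fun _ => (1 : ℝ≥0∞)) x =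
      (Set.Iio ‖φ x‖).indicator (fun _ => 1) t := fun t => by simp [Set.indicator]
  simp_rw [layerSum, h]
  rw [lintegral_indicator measurableSet_Iio, setLIntegral_one,
    Measure.restrict_apply measurableSet_Iio, Set.inter_comm, Set.Ioi_inter_Iio, Real.volume_Ioo,
    sub_zero, ofReal_norm]

/-! ### Symmetric rearrangement of sets. -/

section Sets

variable {d : ℕ}

/-- The radius of the ball `E^*`. -/
noncomputable def symmRearrRadius (E : Set (EuclideanSpace ℝ (Fin d))) : ℝ :=
  (volume E / volume (Metric.ball (0 : EuclideanSpace ℝ (Fin d)) 1)).toReal ^ (1 / (d : ℝ))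

theorem symmRearrSet_eq (E : Set (EuclideanSpace ℝ (Fin d))) :
    symmRearrSet E = Metric.ball 0 (symmRearrRadius E) := rfl

theorem symmRearrRadius_nonneg (E : Set (EuclideanSpace ℝ (Fin d))) : 0 ≤ symmRearrRadius E :=
  Real.rpow_nonneg ENNReal.toReal_nonneg _

theorem volume_unitBall_ne_zero :
    volume (Metric.ball (0 : EuclideanSpace ℝ (Fin d)) 1) ≠ 0 :=
  (Metric.measure_ball_pos volume _ one_pos).ne'

theorem volume_unitBall_ne_top :
    volume (Metric.ball (0 : EuclideanSpace ℝ (Fin d)) 1) ≠ ∞ :=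
  measure_ball_lt_top.ne

theorem volume_ball_eq (hd : 1 ≤ d) (x : EuclideanSpace ℝ (Fin d)) {r : ℝ} (hr : 0 ≤ r) :
    volume (Metric.ball x r) =
      ENNReal.ofReal (r ^ d) * volume (Metric.ball (0 : EuclideanSpace ℝ (Fin d)) 1) := by
  have : Nonempty (Fin d) := ⟨⟨0, hd⟩⟩
  simpa using Measure.addHaar_ball volume x hr

theorem volume_symmRearrSet (hd : 1 ≤ d) {E : Set (EuclideanSpace ℝ (Fin d))}
    (hE : volume E ≠ ∞) : volume (symmRearrSet E) = volume E := by
  have h0 : (d : ℝ) ≠ 0 := by positivity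
  have h1 : symmRearrRadius E ^ d =
      (volume E / volume (Metric.ball (0 : EuclideanSpace ℝ (Fin d)) 1)).toReal := by
    rw [symmRearrRadius, ← Real.rpow_natCast, ← Real.rpow_mul ENNReal.toReal_nonneg,
      one_div_mul_cancel h0, Real.rpow_one]
  rw [symmRearrSet_eq, volume_ball_eq hd _ (symmRearrRadius_nonneg E), h1,
    ENNReal.ofReal_toReal (ENNReal.div_lt_top hE volume_unitBall_ne_zero).ne,
    ENNReal.div_mul_cancel volume_unitBall_ne_zero volume_unitBall_ne_top]

theorem symmRearrRadius_mono {E F : Set (EuclideanSpace ℝ (Fin d))} (h : volume E ≤ volume F)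
    (hF : volume F ≠ ∞) : symmRearrRadius E ≤ symmRearrRadius F := by
  refine Real.rpow_le_rpow ENNReal.toReal_nonneg (ENNReal.toReal_mono
    (ENNReal.div_lt_top hF volume_unitBall_ne_zero).ne (ENNReal.div_le_div_right h _)) (by positivity)

/-- Rearranged sets are concentric balls, hence nested, so their difference has the least measure
that the volumes permit. -/
theorem volume_diff_symmRearrSet_le (hd : 1 ≤ d) {E F : Set (EuclideanSpace ℝ (Fin d))}
    (hE : volume E ≠ ∞) (hF : volume F ≠ ∞) :
    volume (symmRearrSet E \ symmRearrSet F) ≤ volume (E \ F) := by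
  rcases le_total (symmRearrRadius E) (symmRearrRadius F) with h | h
  · have hsub : symmRearrSet E ⊆ symmRearrSet F := Metric.ball_subset_ball h
    rw [Set.sdiff_eq_empty.2 hsub]
    simp
  · have hsub : symmRearrSet F ⊆ symmRearrSet E := Metric.ball_subset_ball h
    rw [measure_sdiff hsub measurableSet_ball.nullMeasurableSet
      measure_ball_lt_top.ne, volume_symmRearrSet hd hE, volume_symmRearrSet hd hF]
    exact le_measure_sdiff

/-- `ψ` is a nonincreasing function of the norm. -/
def RadiallyAntitone {E β : Type*} [Norm E] [LE β] (ψ : E → β) : Prop :=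
  ∀ x y : E, ‖x‖ ≤ ‖y‖ → ψ y ≤ ψ x

/-- `E \ E^*` and `E^* \ E` have equal measure, and the value of `ψ` on the boundary sphere of `E^*`
separates its values on the two. -/
theorem setLIntegral_le_symmRearrSet (hd : 1 ≤ d) {E : Set (EuclideanSpace ℝ (Fin d))}
    (hEm : MeasurableSet E) (hE : volume E ≠ ∞) {ψ : EuclideanSpace ℝ (Fin d) → ℝ≥0∞}
    (hψ : RadiallyAntitone ψ) :
    ∫⁻ x in E, ψ x ≤ ∫⁻ x in symmRearrSet E, ψ x := by
  obtain ⟨e, he⟩ := exists_norm_eq_of_nonneg hd (symmRearrRadius_nonneg E)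
  have hB : MeasurableSet (symmRearrSet E) := measurableSet_ball
  have hvol : volume (E \ symmRearrSet E) = volume (symmRearrSet E \ E) := by
    have h1 := measure_sdiff_add_inter (μ := volume) E hB
    have h2 := measure_sdiff_add_inter (μ := volume) (symmRearrSet E) hEm
    rw [volume_symmRearrSet hd hE, Set.inter_comm, ← h1] at h2
    exact ((ENNReal.add_left_inj (measure_ne_top_of_subset Set.inter_subset_left hE)).1 h2).symm
  rw [← lintegral_inter_add_sdiff ψ E hB, ← lintegral_inter_add_sdiff ψ (symmRearrSet E) hEm,
    Set.inter_comm]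
  refine add_le_add le_rfl ?_
  calc ∫⁻ x in E \ symmRearrSet E, ψ x ≤ ∫⁻ x in E \ symmRearrSet E, ψ e := by
        refine setLIntegral_mono' (hEm.diff hB) fun x hx => hψ _ _ ?_
        have := hx.2
        rw [symmRearrSet_eq, mem_ball_zero_iff, not_lt] at this
        rwa [he]
    _ = ∫⁻ x in symmRearrSet E \ E, ψ e := by simp [hvol]
    _ ≤ _ := by
        refine setLIntegral_mono' (hB.diff hEm) fun x hx => hψ _ _ ?_
        have := hx.1
        rw [symmRearrSet_eq, mem_ball_zero_iff] at this
        rw [he]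
        exact this.le

/-- Such an `E` is a ball up to part of its boundary sphere, so one of `E`, `E^*` contains the
other, and their measures agree. -/
theorem volume_diff_symmRearrSet_eq_zero (hd : 1 ≤ d) {E : Set (EuclideanSpace ℝ (Fin d))}
    (hEm : MeasurableSet E) (hE : volume E ≠ ∞) (h : ∀ x y, ‖x‖ < ‖y‖ → y ∈ E → x ∈ E) :
    volume (E \ symmRearrSet E) = 0 ∧ volume (symmRearrSet E \ E) = 0 := by
  have hv := volume_symmRearrSet hd hE
  by_cases hsub : E ⊆ symmRearrSet E
  · refine ⟨by rw [Set.sdiff_eq_empty.2 hsub, measure_empty], ?_⟩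
    rw [measure_sdiff hsub hEm.nullMeasurableSet hE, hv, tsub_self]
  · obtain ⟨y, hyE, hy⟩ := Set.not_subset.1 hsub
    rw [symmRearrSet_eq, mem_ball_zero_iff, not_lt] at hy
    have hsub' : symmRearrSet E ⊆ E := fun x hx => by
      rw [symmRearrSet_eq, mem_ball_zero_iff] at hx
      exact h x y (hx.trans_le hy) hyE
    refine ⟨?_, by rw [Set.sdiff_eq_empty.2 hsub', measure_empty]⟩
    rw [measure_sdiff hsub' measurableSet_ball.nullMeasurableSet measure_ball_lt_top.ne, hv,
      tsub_self]

end Sets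

/-! ### Symmetric rearrangement of functions. -/

section Functions

variable {d : ℕ} {φ χ : EuclideanSpace ℝ (Fin d) → ℂ}

theorem symmRearr_eq_toReal (φ : EuclideanSpace ℝ (Fin d) → ℂ) (x : EuclideanSpace ℝ (Fin d)) :
    symmRearr φ x = (layerSum (fun t => symmRearrSet {y | t < ‖φ y‖}) x).toReal := rfl

theorem symmRearr_nonneg (φ : EuclideanSpace ℝ (Fin d) → ℂ) (x : EuclideanSpace ℝ (Fin d)) :
    0 ≤ symmRearr φ x := ENNReal.toReal_nonneg

theorem symmRearr_congr_volume
    (h : ∀ t : ℝ, 0 < t → volume {y | t < ‖φ y‖} = volume {y | t < ‖χ y‖}) :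
    symmRearr φ = symmRearr χ := by
  funext x
  unfold symmRearr
  congr 1
  refine setLIntegral_congr_fun measurableSet_Ioi fun t ht => ?_
  simp only [symmRearrSet, h t ht]

theorem symmRearr_congr_ae (h : φ =ᵐ[volume] χ) : symmRearr φ = symmRearr χ :=
  symmRearr_congr_volume fun t _ => measure_congr (by
    filter_upwards [h] with y hy
    change (t < ‖φ y‖) = (t < ‖χ y‖)
    rw [hy])

theorem measurableSet_symmRearrSet_superlevel (φ : EuclideanSpace ℝ (Fin d) → ℂ) :
    MeasurableSet {p : ℝ × EuclideanSpace ℝ (Fin d) | p.2 ∈ symmRearrSet {y | p.1 < ‖φ y‖}} := by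
  have hanti : Antitone fun t : ℝ => volume {y | t < ‖φ y‖} := fun a b hab =>
    measure_mono fun y hy => lt_of_le_of_lt hab hy
  have hr : Measurable fun t : ℝ => symmRearrRadius {y | t < ‖φ y‖} :=
    ((hanti.measurable.div_const _).ennreal_toReal).pow_const _
  have : {p : ℝ × EuclideanSpace ℝ (Fin d) | p.2 ∈ symmRearrSet {y | p.1 < ‖φ y‖}} =
      {p | ‖p.2‖ < symmRearrRadius {y | p.1 < ‖φ y‖}} := by
    ext p
    rw [Set.mem_ofPred_eq, symmRearrSet_eq, mem_ball_zero_iff, Set.mem_ofPred_eq]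
  rw [this]
  exact measurableSet_lt (by fun_prop) (hr.comp measurable_fst)

theorem measurable_symmRearr (φ : EuclideanSpace ℝ (Fin d) → ℂ) : Measurable (symmRearr φ) :=
  (measurable_layerSum (measurableSet_symmRearrSet_superlevel φ)).ennreal_toReal

theorem volume_superlevel_ne_top (hφ : Integrable φ) {t : ℝ} (ht : 0 < t) :
    volume {y | t < ‖φ y‖} ≠ ∞ := (hφ.measure_norm_gt_lt_top ht).ne

theorem lintegral_layerSum_symmRearrSet (hd : 1 ≤ d) (hm : Measurable φ) (hφ : Integrable φ) :
    ∫⁻ x, layerSum (fun t => symmRearrSet {y | t < ‖φ y‖}) x = ∫⁻ x, ‖φ x‖ₑ := by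
  rw [lintegral_layerSum (measurableSet_symmRearrSet_superlevel φ)]
  simp_rw [← layerSum_superlevel φ]
  rw [lintegral_layerSum (measurableSet_superlevel hm)]
  exact setLIntegral_congr_fun measurableSet_Ioi fun t ht =>
    volume_symmRearrSet hd (volume_superlevel_ne_top hφ ht)

theorem layerSum_symmRearrSet_ae_lt_top (hd : 1 ≤ d) (hm : Measurable φ) (hφ : Integrable φ) :
    ∀ᵐ x, layerSum (fun t => symmRearrSet {y | t < ‖φ y‖}) x < ∞ := by
  refine ae_lt_top (measurable_layerSum (measurableSet_symmRearrSet_superlevel φ)) ?_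
  rw [lintegral_layerSum_symmRearrSet hd hm hφ]
  exact hφ.2.ne

theorem ofReal_symmRearr_ae (hd : 1 ≤ d) (hm : Measurable φ) (hφ : Integrable φ) :
    (fun x => ENNReal.ofReal (symmRearr φ x)) =ᵐ[volume]
      layerSum (fun t => symmRearrSet {y | t < ‖φ y‖}) := by
  filter_upwards [layerSum_symmRearrSet_ae_lt_top hd hm hφ] with x hx
  exact ENNReal.ofReal_toReal hx.ne

theorem integrable_symmRearr_of_measurable (hd : 1 ≤ d) (hm : Measurable φ) (hφ : Integrable φ) :
    Integrable (symmRearr φ) := by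
  refine ⟨(measurable_symmRearr φ).aestronglyMeasurable, ?_⟩
  rw [hasFiniteIntegral_iff_ofReal (ae_of_all _ (symmRearr_nonneg φ)),
    lintegral_congr_ae (ofReal_symmRearr_ae hd hm hφ), lintegral_layerSum_symmRearrSet hd hm hφ]
  exact hφ.2

theorem integrable_symmRearr (hd : 1 ≤ d) (hφ : Integrable φ) : Integrable (symmRearr φ) := by
  rw [symmRearr_congr_ae hφ.1.ae_eq_mk]
  exact integrable_symmRearr_of_measurable hd hφ.1.stronglyMeasurable_mk.measurable
    (hφ.congr hφ.1.ae_eq_mk)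

/-- The Hardy-Littlewood inequality against a radially nonincreasing function. -/
theorem integral_mul_norm_le_integral_mul_symmRearr (hd : 1 ≤ d) (hφ : Integrable φ)
    {ψ : EuclideanSpace ℝ (Fin d) → ℝ} (hψ : RadiallyAntitone ψ) (hψ0 : 0 ≤ ψ)
    (hψc : Continuous ψ) :
    ∫ x, ψ x * ‖φ x‖ ≤ ∫ x, ψ x * symmRearr φ x := by
  wlog hm : Measurable φ generalizing φ
  · rw [symmRearr_congr_ae hφ.1.ae_eq_mk]
    refine le_trans (le_of_eq (integral_congr_ae ?_)) (this (hφ.congr hφ.1.ae_eq_mk)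
      hφ.1.stronglyMeasurable_mk.measurable)
    filter_upwards [hφ.1.ae_eq_mk] with x hx
    rw [← hx]
  have hbdd : ∀ x, ‖ψ x‖ ≤ ψ 0 := fun x => by
    rw [Real.norm_of_nonneg (hψ0 x)]
    exact hψ _ _ (by simp)
  have hψm : Measurable fun x => ENNReal.ofReal (ψ x) := hψc.measurable.ennreal_ofReal
  have hi : Integrable fun x => ψ x * symmRearr φ x :=
    (integrable_symmRearr hd hφ).bdd_mul hψc.aestronglyMeasurable (ae_of_all _ hbdd)
  rw [integral_eq_lintegral_of_nonneg_ae (ae_of_all _ fun x => mul_nonneg (hψ0 x) (norm_nonneg _))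
      (hψc.aestronglyMeasurable.mul hm.norm.aestronglyMeasurable),
    integral_eq_lintegral_of_nonneg_ae
      (ae_of_all _ fun x => mul_nonneg (hψ0 x) (symmRearr_nonneg _ _)) hi.1]
  refine ENNReal.toReal_mono ?_ ?_
  · exact ((hasFiniteIntegral_iff_ofReal
      (ae_of_all _ fun x => mul_nonneg (hψ0 x) (symmRearr_nonneg _ _))).1 hi.2).ne
  calc ∫⁻ x, ENNReal.ofReal (ψ x * ‖φ x‖)
      = ∫⁻ x, ENNReal.ofReal (ψ x) * layerSum (fun t => {y | t < ‖φ y‖}) x := by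
        refine lintegral_congr fun x => ?_
        rw [ENNReal.ofReal_mul (hψ0 x), layerSum_superlevel, ofReal_norm]
    _ = ∫⁻ t in Set.Ioi (0 : ℝ), ∫⁻ x in {y | t < ‖φ y‖}, ENNReal.ofReal (ψ x) :=
        lintegral_mul_layerSum (measurableSet_superlevel hm) hψm
    _ ≤ ∫⁻ t in Set.Ioi (0 : ℝ), ∫⁻ x in symmRearrSet {y | t < ‖φ y‖}, ENNReal.ofReal (ψ x) := by
        refine setLIntegral_mono' measurableSet_Ioi fun t ht =>
          setLIntegral_le_symmRearrSet hd (measurableSet_lt measurable_const hm.norm)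
            (volume_superlevel_ne_top hφ ht) fun x y hxy => ENNReal.ofReal_le_ofReal (hψ x y hxy)
    _ = ∫⁻ x, ENNReal.ofReal (ψ x) * layerSum (fun t => symmRearrSet {y | t < ‖φ y‖}) x :=
        (lintegral_mul_layerSum (measurableSet_symmRearrSet_superlevel φ) hψm).symm
    _ = ∫⁻ x, ENNReal.ofReal (ψ x * symmRearr φ x) := by
        refine lintegral_congr_ae ?_
        filter_upwards [ofReal_symmRearr_ae hd hm hφ] with x hx
        rw [ENNReal.ofReal_mul (hψ0 x), hx]

theorem lintegral_symmRearr_sub_le (hd : 1 ≤ d) (hm : Measurable φ) (hφ : Integrable φ)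
    (hm' : Measurable χ) (hχ : Integrable χ) :
    ∫⁻ x, ENNReal.ofReal (symmRearr φ x - symmRearr χ x) ≤
      ∫⁻ x, ENNReal.ofReal (‖φ x‖ - ‖χ x‖) := by
  calc ∫⁻ x, ENNReal.ofReal (symmRearr φ x - symmRearr χ x)
      = ∫⁻ x, (layerSum (fun t => symmRearrSet {y | t < ‖φ y‖}) x -
          layerSum (fun t => symmRearrSet {y | t < ‖χ y‖}) x) := by
        refine lintegral_congr_ae ?_
        filter_upwards [ofReal_symmRearr_ae hd hm hφ, ofReal_symmRearr_ae hd hm' hχ] with x h1 h2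
        rw [ENNReal.ofReal_sub _ (symmRearr_nonneg _ _), h1, h2]
    _ ≤ ∫⁻ t in Set.Ioi (0 : ℝ),
          volume (symmRearrSet {y | t < ‖φ y‖} \ symmRearrSet {y | t < ‖χ y‖}) :=
        lintegral_layerSum_sub_le (measurableSet_symmRearrSet_superlevel φ)
          (measurableSet_symmRearrSet_superlevel χ)
    _ ≤ ∫⁻ t in Set.Ioi (0 : ℝ), volume ({y | t < ‖φ y‖} \ {y | t < ‖χ y‖}) :=
        setLIntegral_mono' measurableSet_Ioi fun t ht => volume_diff_symmRearrSet_le hd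
          (volume_superlevel_ne_top hφ ht) (volume_superlevel_ne_top hχ ht)
    _ = ∫⁻ x, layerSum (fun t => {y | t < ‖φ y‖} \ {y | t < ‖χ y‖}) x :=
        (lintegral_layerSum (U := fun t => {y | t < ‖φ y‖} \ {y | t < ‖χ y‖})
          ((measurableSet_superlevel hm).diff (measurableSet_superlevel hm'))).symm
    _ = _ := by
        refine lintegral_congr fun x => ?_
        -- At fixed `x` the heights in the difference of layers form the interval `[‖χ x‖, ‖φ x‖)`,
        -- whose length is the positive part of `‖φ x‖ - ‖χ x‖`.
        have h : ∀ t : ℝ, ({y | t < ‖φ y‖} \ {y | t < ‖χ y‖}).indicator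
            (fun _ => (1 : ℝ≥0∞)) x = (Set.Ico ‖χ x‖ ‖φ x‖).indicator (fun _ => 1) t := fun t => by
          simp [Set.indicator, and_comm]
        simp_rw [layerSum, h]
        rw [lintegral_indicator measurableSet_Ico, setLIntegral_one,
          ← Real.volume_Ico, Measure.restrict_congr_set Ioi_ae_eq_Ici,
          Measure.restrict_apply measurableSet_Ico, Set.inter_eq_left.2]
        exact fun t ht => (norm_nonneg _).trans ht.1

/-- Rearrangement is a contraction of `L¹`. -/
theorem integral_abs_symmRearr_sub_le (hd : 1 ≤ d) (hm : Measurable φ) (hφ : Integrable φ)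
    (hm' : Measurable χ) (hχ : Integrable χ) :
    ∫ x, |symmRearr φ x - symmRearr χ x| ≤ ∫ x, |‖φ x‖ - ‖χ x‖| := by
  have habs : ∀ a b : ℝ, ENNReal.ofReal |a - b| =
      ENNReal.ofReal (a - b) + ENNReal.ofReal (b - a) := fun a b => by
    rcases le_total a b with h | h
    · rw [abs_of_nonpos (by linarith), ENNReal.ofReal_of_nonpos (p := a - b) (by linarith),
        zero_add, neg_sub]
    · rw [abs_of_nonneg (by linarith), ENNReal.ofReal_of_nonpos (p := b - a) (by linarith),
        add_zero]
  have hi : Integrable fun x => |‖φ x‖ - ‖χ x‖| := (hφ.norm.sub hχ.norm).abs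
  have hmφ := measurable_symmRearr φ
  have hmχ := measurable_symmRearr χ
  rw [integral_eq_lintegral_of_nonneg_ae (ae_of_all _ fun x => abs_nonneg _)
      (by fun_prop : Measurable fun x => |symmRearr φ x - symmRearr χ x|).aestronglyMeasurable,
    integral_eq_lintegral_of_nonneg_ae (ae_of_all _ fun x => abs_nonneg _) hi.1]
  refine ENNReal.toReal_mono
    ((hasFiniteIntegral_iff_ofReal (ae_of_all _ fun x => abs_nonneg _)).1 hi.2).ne ?_
  simp_rw [habs]
  rw [lintegral_add_left (by fun_prop), lintegral_add_left (by fun_prop)]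
  exact add_le_add (lintegral_symmRearr_sub_le hd hm hφ hm' hχ)
    (lintegral_symmRearr_sub_le hd hm' hχ hm hφ)

/-- The superlevel sets at positive heights are balls up to null sets, so both one-sided layer
comparisons vanish. -/
theorem symmRearr_ae_eq_norm (hd : 1 ≤ d) (hm : Measurable φ) (hφ : Integrable φ)
    (h : ∀ x y, ‖x‖ < ‖y‖ → ‖φ y‖ ≤ ‖φ x‖) :
    symmRearr φ =ᵐ[volume] fun x => ‖φ x‖ := by
  have h0 : ∀ t : ℝ, 0 < t → volume ({y | t < ‖φ y‖} \ symmRearrSet {y | t < ‖φ y‖}) = 0 ∧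
      volume (symmRearrSet {y | t < ‖φ y‖} \ {y | t < ‖φ y‖}) = 0 := fun t ht =>
    volume_diff_symmRearrSet_eq_zero hd (measurableSet_lt measurable_const hm.norm)
      (volume_superlevel_ne_top hφ ht) fun x y hxy hy => lt_of_lt_of_le hy (h x y hxy)
  have hU := measurableSet_superlevel hm
  have hW := measurableSet_symmRearrSet_superlevel φ
  have h1 := lintegral_layerSum_sub_le (μ := volume) (U := fun t => {y | t < ‖φ y‖})
    (W := fun t => symmRearrSet {y | t < ‖φ y‖}) hU hW
  have h2 := lintegral_layerSum_sub_le (μ := volume) (U := fun t => symmRearrSet {y | t < ‖φ y‖})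
    (W := fun t => {y | t < ‖φ y‖}) hW hU
  rw [setLIntegral_congr_fun measurableSet_Ioi (g := fun _ => 0) fun t ht => (h0 t ht).1,
    lintegral_zero, nonpos_iff_eq_zero] at h1
  replace h1 := (lintegral_eq_zero_iff
    ((measurable_layerSum hU).sub (measurable_layerSum hW))).1 h1
  rw [setLIntegral_congr_fun measurableSet_Ioi (g := fun _ => 0) fun t ht => (h0 t ht).2,
    lintegral_zero, nonpos_iff_eq_zero] at h2
  replace h2 := (lintegral_eq_zero_iff
    ((measurable_layerSum hW).sub (measurable_layerSum hU))).1 h2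
  filter_upwards [h1, h2] with x hx1 hx2
  have h3 := le_antisymm (tsub_eq_zero_iff_le.1 hx2) (tsub_eq_zero_iff_le.1 hx1)
  rw [symmRearr_eq_toReal, h3, layerSum_superlevel, toReal_enorm]

theorem symmRearr_eq_zero (hS : volume (Function.support φ) ≠ ∞) {x : EuclideanSpace ℝ (Fin d)}
    (hx : symmRearrRadius (Function.support φ) ≤ ‖x‖) : symmRearr φ x = 0 := by
  have h : layerSum (fun t => symmRearrSet {y | t < ‖φ y‖}) x = 0 := by
    unfold layerSum
    rw [setLIntegral_congr_fun measurableSet_Ioi (g := fun _ => 0) fun t ht => ?_, lintegral_zero]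
    refine Set.indicator_of_notMem ?_ _
    simp only [symmRearrSet_eq, mem_ball_zero_iff, not_lt]
    refine (symmRearrRadius_mono (measure_mono fun y hy => ?_) hS).trans hx
    have : 0 < ‖φ y‖ := lt_trans ht hy
    exact norm_pos_iff.1 this
  rw [symmRearr_eq_toReal, h, ENNReal.toReal_zero]

end Functions

/-! ### Hyperplane reflections and polarization. -/

section Polarization

variable {E : Type*} [NormedAddCommGroup E] [InnerProductSpace ℝ E]

/-- Reflection in the hyperplane `⟪u, z⟫ = c`, for a unit vector `u`. -/
noncomputable def hyperplaneReflection (u : E) (c : ℝ) (z : E) : E :=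
  z + (2 * (c - inner ℝ u z)) • u

theorem continuous_hyperplaneReflection (u : E) (c : ℝ) :
    Continuous (hyperplaneReflection u c) := by
  unfold hyperplaneReflection
  fun_prop

section Reflection

variable {u : E} {c : ℝ} (hu : ‖u‖ = 1)
include hu

theorem inner_hyperplaneReflection (z : E) :
    inner ℝ u (hyperplaneReflection u c z) = 2 * c - inner ℝ u z := by
  rw [hyperplaneReflection, inner_add_right, inner_smul_right, real_inner_self_eq_norm_sq, hu]
  ring

theorem hyperplaneReflection_involutive (z : E) :
    hyperplaneReflection u c (hyperplaneReflection u c z) = z := by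
  rw [hyperplaneReflection, inner_hyperplaneReflection hu, hyperplaneReflection, add_assoc,
    ← add_smul]
  ring_nf
  simp

/-- The sign of the product tells whether `x` and `y` lie on the same side of the hyperplane; points
on the same side are nearer to each other than to their mirror images. -/
theorem norm_sub_hyperplaneReflection_sq (x y : E) :
    ‖x - hyperplaneReflection u c y‖ ^ 2 =
      ‖x - y‖ ^ 2 + 4 * ((c - inner ℝ u x) * (c - inner ℝ u y)) := by
  rw [hyperplaneReflection, ← sub_sub, norm_sub_sq_real, inner_smul_right, norm_smul, hu,
    real_inner_comm u (x - y), inner_sub_right, mul_one, Real.norm_eq_abs, sq_abs]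
  ring

theorem norm_hyperplaneReflection_sq (z : E) :
    ‖hyperplaneReflection u c z‖ ^ 2 = ‖z‖ ^ 2 + 4 * (c * (c - inner ℝ u z)) := by
  simpa using norm_sub_hyperplaneReflection_sq hu (c := c) 0 z

theorem norm_hyperplaneReflection_sub (x y : E) :
    ‖hyperplaneReflection u c x - y‖ = ‖x - hyperplaneReflection u c y‖ := by
  rw [← sq_eq_sq₀ (norm_nonneg _) (norm_nonneg _), norm_sub_rev,
    norm_sub_hyperplaneReflection_sq hu, norm_sub_hyperplaneReflection_sq hu, norm_sub_rev]
  ring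

theorem norm_hyperplaneReflection_sub_hyperplaneReflection (x y : E) :
    ‖hyperplaneReflection u c x - hyperplaneReflection u c y‖ = ‖x - y‖ := by
  rw [norm_hyperplaneReflection_sub hu, hyperplaneReflection_involutive hu]

variable [FiniteDimensional ℝ E] [MeasurableSpace E] [BorelSpace E]

theorem measurePreserving_hyperplaneReflection :
    MeasurePreserving (hyperplaneReflection u c) (volume : Measure E) volume := by
  have h : hyperplaneReflection u c =
      (fun z => z + (2 * c) • u) ∘ ((ℝ ∙ u)ᗮ.reflection) := by
    funext z
    simp only [Function.comp_apply, hyperplaneReflection]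
    rw [Submodule.reflection_orthogonal_apply, Submodule.reflection_singleton_apply, hu]
    simp only [RCLike.ofReal_real_eq_id, id_eq, one_pow, div_one, mul_sub, sub_smul, two_smul,
      neg_sub, mul_smul]
    abel
  rw [h]
  exact (measurePreserving_add_right volume _).comp (LinearIsometryEquiv.measurePreserving _)

end Reflection

/-- The polarization (two-point rearrangement) of `f` towards the half-space `⟪u, z⟫ ≤ c`. -/
noncomputable def polarization (u : E) (c : ℝ) (f : E → ℝ) (z : E) : ℝ :=
  if inner ℝ u z ≤ c then max (f z) (f (hyperplaneReflection u c z))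
  else min (f z) (f (hyperplaneReflection u c z))

variable {u : E} {c : ℝ} (hu : ‖u‖ = 1) {f : E → ℝ}
include hu

/-- The single case split behind all polarization estimates: each mirror pair has its values sorted.
On the hyperplane both alternatives hold. -/
theorem polarization_pair (f : E → ℝ) (z : E) :
    (inner ℝ u z ≤ c ∧ polarization u c f z = max (f z) (f (hyperplaneReflection u c z)) ∧
      polarization u c f (hyperplaneReflection u c z) =
        min (f z) (f (hyperplaneReflection u c z))) ∨
    (c ≤ inner ℝ u z ∧ polarization u c f z = min (f z) (f (hyperplaneReflection u c z)) ∧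
      polarization u c f (hyperplaneReflection u c z) =
        max (f z) (f (hyperplaneReflection u c z))) := by
  have h1 := inner_hyperplaneReflection hu (c := c) z
  have h2 := hyperplaneReflection_involutive hu (c := c) z
  rcases lt_trichotomy (inner ℝ u z) c with h | h | h
  · left
    refine ⟨h.le, by rw [polarization, if_pos h.le], ?_⟩
    rw [polarization, if_neg (by rw [h1]; linarith), h2, min_comm]
  · left
    have h3 : hyperplaneReflection u c z = z := by simp [hyperplaneReflection, h]
    simp [polarization, h3, h]
  · right
    refine ⟨h.le, by rw [polarization, if_neg (not_le.2 h)], ?_⟩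
    rw [polarization, if_pos (by rw [h1]; linarith), h2, max_comm]

/-- On the same side two maxima or two minima are compared, for which the straight differences
suffice. On opposite sides `x` is no farther from `σ y` than from `y`, so the crossed differences
are controlled as well and any choice of values is harmless. -/
theorem polarization_modulus {δ ε : ℝ} (hδ : ∀ x y, ‖x - y‖ ≤ δ → |f x - f y| ≤ ε) (x y : E)
    (hxy : ‖x - y‖ ≤ δ) : |polarization u c f x - polarization u c f y| ≤ ε := by
  set σ := hyperplaneReflection u c with hσ
  have e1 := hδ _ _ hxy
  have e2 := hδ (σ x) (σ y)
    (by rwa [hσ, norm_hyperplaneReflection_sub_hyperplaneReflection hu])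
  rw [abs_le] at e1 e2 ⊢
  have hsq := norm_sub_hyperplaneReflection_sq hu (c := c) x y
  have hopp : (c - inner ℝ u x) * (c - inner ℝ u y) ≤ 0 →
      |f x - f (σ y)| ≤ ε ∧ |f (σ x) - f y| ≤ ε := fun hs => by
    have hle : ‖x - σ y‖ ≤ δ := by
      refine le_trans ?_ hxy
      rw [← sq_le_sq₀ (norm_nonneg _) (norm_nonneg _), hσ, hsq]
      linarith
    exact ⟨hδ _ _ hle, hδ _ _ (by rwa [hσ, norm_hyperplaneReflection_sub hu])⟩
  rcases polarization_pair hu (c := c) f x with ⟨hx, h1, -⟩ | ⟨hx, h1, -⟩ <;>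
  rcases polarization_pair hu (c := c) f y with ⟨hy, h2, -⟩ | ⟨hy, h2, -⟩ <;>
  rw [h1, h2, ← hσ]
  · constructor
    · rcases max_choice (f y) (f (σ y)) with h | h <;> rw [h] <;>
      linarith [le_max_left (f x) (f (σ x)), le_max_right (f x) (f (σ x))]
    · rcases max_choice (f x) (f (σ x)) with h | h <;> rw [h] <;>
      linarith [le_max_left (f y) (f (σ y)), le_max_right (f y) (f (σ y))]
  · obtain ⟨e3, e4⟩ := hopp (mul_nonpos_of_nonneg_of_nonpos (by linarith) (by linarith))
    rw [abs_le] at e3 e4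
    rcases max_choice (f x) (f (σ x)) with h | h <;>
    rcases min_choice (f y) (f (σ y)) with h' | h' <;>
    rw [h, h'] <;> constructor <;> linarith
  · obtain ⟨e3, e4⟩ := hopp (mul_nonpos_of_nonpos_of_nonneg (by linarith) (by linarith))
    rw [abs_le] at e3 e4
    rcases min_choice (f x) (f (σ x)) with h | h <;>
    rcases max_choice (f y) (f (σ y)) with h' | h' <;>
    rw [h, h'] <;> constructor <;> linarith
  · constructor
    · rcases min_choice (f x) (f (σ x)) with h | h <;> rw [h] <;>
      linarith [min_le_left (f y) (f (σ y)), min_le_right (f y) (f (σ y))]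
    · rcases min_choice (f y) (f (σ y)) with h | h <;> rw [h] <;>
      linarith [min_le_left (f x) (f (σ x)), min_le_right (f x) (f (σ x))]

theorem polarization_mem_Icc {M : ℝ} (hf : ∀ z, f z ∈ Set.Icc 0 M) (z : E) :
    polarization u c f z ∈ Set.Icc 0 M := by
  rcases polarization_pair hu (c := c) f z with ⟨-, h, -⟩ | ⟨-, h, -⟩ <;> rw [h]
  · rcases max_choice (f z) (f (hyperplaneReflection u c z)) with h | h <;> rw [h] <;> exact hf _
  · rcases min_choice (f z) (f (hyperplaneReflection u c z)) with h | h <;> rw [h] <;> exact hf _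

/-- With `0 ≤ c` the origin lies in the favoured half-space, so reflecting a point of that
half-space does not bring it closer to the origin. -/
theorem polarization_eq_zero (hc : 0 ≤ c) (hf : 0 ≤ f) {R : ℝ} (hR : ∀ z, R ≤ ‖z‖ → f z = 0)
    {z : E} (hz : R ≤ ‖z‖) : polarization u c f z = 0 := by
  rcases polarization_pair hu (c := c) f z with ⟨hp, h, -⟩ | ⟨-, h, -⟩ <;> rw [h, hR z hz]
  · have hle : ‖z‖ ≤ ‖hyperplaneReflection u c z‖ := by
      rw [← sq_le_sq₀ (norm_nonneg _) (norm_nonneg _), norm_hyperplaneReflection_sq hu]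
      have := mul_nonneg hc (sub_nonneg.2 hp)
      linarith
    rw [hR _ (hz.trans hle), max_self]
  · exact min_eq_left (hf _)

variable [FiniteDimensional ℝ E] [MeasurableSpace E] [BorelSpace E]

theorem integral_eq_half_add_reflection {F : E → ℝ} (hF : Integrable F) :
    ∫ z, F z = 2⁻¹ * ∫ z, (F z + F (hyperplaneReflection u c z)) := by
  have hp := measurePreserving_hyperplaneReflection hu (c := c)
  have h1 : ∫ z, F (hyperplaneReflection u c z) = ∫ z, F z := by
    rw [← integral_map hp.aemeasurable (by rw [hp.map_eq]; exact hF.1), hp.map_eq]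
  have h2 : Integrable fun z => F (hyperplaneReflection u c z) :=
    hp.integrable_comp_of_integrable hF
  rw [integral_add hF h2, h1]
  ring

theorem integral_comp_polarization {Φ : ℝ → ℝ} (h1 : Integrable fun z => Φ (f z))
    (h2 : Integrable fun z => Φ (polarization u c f z)) :
    ∫ z, Φ (polarization u c f z) = ∫ z, Φ (f z) := by
  rw [integral_eq_half_add_reflection hu (c := c) h1, integral_eq_half_add_reflection hu (c := c) h2]
  congr 1
  refine integral_congr_ae (ae_of_all _ fun z => ?_)
  dsimp only
  rcases polarization_pair hu (c := c) f z with ⟨-, h, h'⟩ | ⟨-, h, h'⟩ <;> rw [h, h'] <;>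
  rcases le_total (f z) (f (hyperplaneReflection u c z)) with hle | hle <;> simp [hle, add_comm]

/-- Summed over a mirror pair, the loss is `4c(c - ⟪u, z⟫)(f(σz) - f(z))` where values get
exchanged, and zero otherwise. It is nonnegative, and positive at `x`. -/
theorem integral_norm_sq_mul_polarization_lt (hc : 0 < c) (hf : Continuous f)
    (hpf : Continuous (polarization u c f)) (hfs : HasCompactSupport f)
    (hps : HasCompactSupport (polarization u c f)) {x : E} (hx : inner ℝ u x < c)
    (hfx : f x < f (hyperplaneReflection u c x)) :
    ∫ z, ‖z‖ ^ 2 * polarization u c f z < ∫ z, ‖z‖ ^ 2 * f z := by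
  have i1 : Integrable fun z => ‖z‖ ^ 2 * f z :=
    (by fun_prop : Continuous _).integrable_of_hasCompactSupport hfs.mul_left
  have i2 : Integrable fun z => ‖z‖ ^ 2 * polarization u c f z :=
    (by fun_prop : Continuous _).integrable_of_hasCompactSupport hps.mul_left
  rw [← sub_pos, ← integral_sub i1 i2,
    integral_eq_half_add_reflection hu (c := c)
      (F := fun z => ‖z‖ ^ 2 * f z - ‖z‖ ^ 2 * polarization u c f z) (i1.sub i2)]
  refine mul_pos (by norm_num) ?_
  have hσ := continuous_hyperplaneReflection u c
  have hσp : Topology.IsClosedEmbedding (hyperplaneReflection u c) :=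
    (Homeomorph.mk (Equiv.mk _ _ (hyperplaneReflection_involutive hu (c := c))
      (hyperplaneReflection_involutive hu)) hσ hσ).isClosedEmbedding
  have hcs : HasCompactSupport fun z => ‖z‖ ^ 2 * f z - ‖z‖ ^ 2 * polarization u c f z :=
    HasCompactSupport.sub hfs.mul_left hps.mul_left
  refine Continuous.integral_pos_of_hasCompactSupport_nonneg_nonzero (x := x) ?_ ?_ ?_ ?_
  · fun_prop
  · exact HasCompactSupport.add hcs (hcs.comp_isClosedEmbedding hσp)
  · intro z
    simp only [Pi.zero_apply]
    have hn := norm_hyperplaneReflection_sq hu (c := c) z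
    rcases polarization_pair hu (c := c) f z with ⟨hz, h, h'⟩ | ⟨hz, h, h'⟩ <;> rw [h, h', hn] <;>
    rcases le_total (f z) (f (hyperplaneReflection u c z)) with hle | hle
    · rw [max_eq_right hle, min_eq_left hle]
      nlinarith [mul_nonneg (mul_nonneg hc.le (sub_nonneg.2 hz)) (sub_nonneg.2 hle)]
    · rw [max_eq_left hle, min_eq_right hle]
      linarith
    · rw [max_eq_right hle, min_eq_left hle]
      linarith
    · rw [max_eq_left hle, min_eq_right hle]
      nlinarith [mul_nonneg (mul_nonneg hc.le (sub_nonneg.2 hz)) (sub_nonneg.2 hle)]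
  · have hn := norm_hyperplaneReflection_sq hu (c := c) x
    rcases polarization_pair hu (c := c) f x with ⟨hz, h, h'⟩ | ⟨hz, h, h'⟩
    · rw [h, h', hn, max_eq_right hfx.le, min_eq_left hfx.le]
      have := mul_pos (mul_pos hc (sub_pos.2 hx)) (sub_pos.2 hfx)
      intro h0
      nlinarith
    · exact absurd hx (not_lt.2 hz)

end Polarization

/-! ### Radially nonincreasing kernels; the Riesz energy under polarization. -/

section RadiallyAntitone

variable {E : Type*} [NormedAddCommGroup E] {ψ : E → ℝ}

theorem RadiallyAntitone.eq_of_norm_eq (h : RadiallyAntitone ψ) {x y : E} (hxy : ‖x‖ = ‖y‖) :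
    ψ x = ψ y := le_antisymm (h _ _ hxy.ge) (h _ _ hxy.le)

theorem RadiallyAntitone.norm_le (h : RadiallyAntitone ψ) (h0 : 0 ≤ ψ) (x : E) : ‖ψ x‖ ≤ ψ 0 := by
  rw [Real.norm_of_nonneg (h0 x)]
  exact h _ _ (by simp)

end RadiallyAntitone

section Energy

variable {E : Type*} [NormedAddCommGroup E] [InnerProductSpace ℝ E] [FiniteDimensional ℝ E]
  [MeasurableSpace E] [BorelSpace E] {ψ f g : E → ℝ}

/-- The Riesz energy `∬ ψ(x - y) f(x) f(y) dx dy`. -/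
noncomputable def rieszEnergy (ψ f : E → ℝ) : ℝ :=
  ∫ p : E × E, ψ (p.1 - p.2) * (f p.1 * f p.2)

theorem integrable_rieszEnergy (h : RadiallyAntitone ψ) (h0 : 0 ≤ ψ) (hψ : Continuous ψ)
    (hf : Integrable f) (hg : Integrable g) :
    Integrable fun p : E × E => ψ (p.1 - p.2) * (f p.1 * g p.2) :=
  (hf.mul_prod hg).bdd_mul (c := ψ 0) (by fun_prop : Continuous _).aestronglyMeasurable
    (ae_of_all _ fun _ => h.norm_le h0 _)

/-- The gain is `0` or `(l - s)|a - b||c - d|`: the larger weight should multiply the similarly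
ordered products. -/
theorem two_point_inequality (a b c d : ℝ) {s l : ℝ} (h : s ≤ l) :
    l * (a * c + b * d) + s * (a * d + b * c) ≤
      l * (max a b * max c d + min a b * min c d) +
        s * (max a b * min c d + min a b * max c d) := by
  rcases le_total a b with hab | hab <;> rcases le_total c d with hcd | hcd <;>
  simp only [max_eq_left, max_eq_right, min_eq_left, min_eq_right, hab, hcd]
  · linarith
  · nlinarith [mul_nonneg (mul_nonneg (sub_nonneg.2 h) (sub_nonneg.2 hab)) (sub_nonneg.2 hcd)]
  · nlinarith [mul_nonneg (mul_nonneg (sub_nonneg.2 h) (sub_nonneg.2 hab)) (sub_nonneg.2 hcd)]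
  · linarith

/-- Averaging over the four reflections of `(x, y)` leaves only two kernel values, `ψ(x - y)` and
`ψ(x - σy)`, and the claim becomes the two-point inequality. -/
theorem rieszEnergy_le_polarization (h : RadiallyAntitone ψ) (h0 : 0 ≤ ψ) (hψ : Continuous ψ)
    {u : E} {c : ℝ} (hu : ‖u‖ = 1) (hf : Integrable f) (hp : Integrable (polarization u c f)) :
    rieszEnergy ψ f ≤ rieszEnergy ψ (polarization u c f) := by
  set σ := hyperplaneReflection u c with hσ
  have hσm : MeasurePreserving σ (volume : Measure E) volume :=
    measurePreserving_hyperplaneReflection hu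
  have hid := MeasurePreserving.id (volume : Measure E)
  have hcomp : ∀ {F : E × E → ℝ}, Integrable F → ∀ {T : E × E → E × E},
      MeasurePreserving T volume volume → ∫ p, F (T p) = ∫ p, F p := fun hF T hT => by
    rw [← integral_map hT.aemeasurable (by rw [hT.map_eq]; exact hF.1), hT.map_eq]
  have t1 : MeasurePreserving (Prod.map σ σ) (volume : Measure (E × E)) volume := hσm.prod hσm
  have t2 : MeasurePreserving (Prod.map id σ) (volume : Measure (E × E)) volume := hid.prod hσm
  have t3 : MeasurePreserving (Prod.map σ id) (volume : Measure (E × E)) volume := hσm.prod hid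
  have quad : ∀ {F : E × E → ℝ}, Integrable F →
      Integrable (fun p => F p + F (Prod.map σ σ p) + F (Prod.map id σ p) + F (Prod.map σ id p)) ∧
      ∫ p, F p = 4⁻¹ * ∫ p, (F p + F (Prod.map σ σ p) + F (Prod.map id σ p) +
        F (Prod.map σ id p)) := fun {F} hF => by
    have j1 : Integrable fun p => F (Prod.map σ σ p) := t1.integrable_comp_of_integrable hF
    have j2 : Integrable fun p => F (Prod.map id σ p) := t2.integrable_comp_of_integrable hF
    have j3 : Integrable fun p => F (Prod.map σ id p) := t3.integrable_comp_of_integrable hF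
    refine ⟨((hF.add j1).add j2).add j3, ?_⟩
    have e1 := integral_add ((hF.add j1).add j2) j3
    have e2 := integral_add (hF.add j1) j2
    have e3 := integral_add hF j1
    simp only [Pi.add_apply] at e1 e2 e3
    rw [e1, e2, e3, hcomp hF t1, hcomp hF t2, hcomp hF t3]
    ring
  obtain ⟨i1, q1⟩ := quad (integrable_rieszEnergy h h0 hψ hf hf)
  obtain ⟨i2, q2⟩ := quad (integrable_rieszEnergy h h0 hψ hp hp)
  unfold rieszEnergy
  rw [q1, q2]
  refine mul_le_mul_of_nonneg_left (integral_mono i1 i2 fun p => ?_) (by norm_num)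
  obtain ⟨x, y⟩ := p
  simp only [Prod.map_apply, id_eq]
  have n1 : ψ (σ x - σ y) = ψ (x - y) :=
    h.eq_of_norm_eq (norm_hyperplaneReflection_sub_hyperplaneReflection hu x y)
  have n2 : ψ (σ x - y) = ψ (x - σ y) := h.eq_of_norm_eq (norm_hyperplaneReflection_sub hu x y)
  have hsq := norm_sub_hyperplaneReflection_sq hu (c := c) x y
  have same : 0 ≤ (c - inner ℝ u x) * (c - inner ℝ u y) → ψ (x - σ y) ≤ ψ (x - y) := fun hs => by
    refine h _ _ ?_
    rw [← sq_le_sq₀ (norm_nonneg _) (norm_nonneg _), hσ, hsq]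
    linarith
  have opp : (c - inner ℝ u x) * (c - inner ℝ u y) ≤ 0 → ψ (x - y) ≤ ψ (x - σ y) := fun hs => by
    refine h _ _ ?_
    rw [← sq_le_sq₀ (norm_nonneg _) (norm_nonneg _), hσ, hsq]
    linarith
  rw [n1, n2]
  rcases polarization_pair hu (c := c) f x with ⟨hx, h1, h1'⟩ | ⟨hx, h1, h1'⟩ <;>
  rcases polarization_pair hu (c := c) f y with ⟨hy, h2, h2'⟩ | ⟨hy, h2, h2'⟩ <;>
  rw [h1, h2, h1', h2', ← hσ]
  · have := two_point_inequality (f x) (f (σ x)) (f y) (f (σ y))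
      (same (mul_nonneg (by linarith) (by linarith)))
    linarith
  · have := two_point_inequality (f x) (f (σ x)) (f y) (f (σ y))
      (opp (mul_nonpos_of_nonneg_of_nonpos (by linarith) (by linarith)))
    -- On opposite sides `ψ(x - σy)` is the larger weight, so `y` and `σ y` exchange roles.
    have := two_point_inequality (f x) (f (σ x)) (f (σ y)) (f y)
      (opp (mul_nonpos_of_nonneg_of_nonpos (by linarith) (by linarith)))
    rw [max_comm (f (σ y)), min_comm (f (σ y))] at this
    linarith
  · have := two_point_inequality (f x) (f (σ x)) (f (σ y)) (f y)
      (opp (mul_nonpos_of_nonpos_of_nonneg (by linarith) (by linarith)))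
    rw [max_comm (f (σ y)), min_comm (f (σ y))] at this
    linarith
  · have := two_point_inequality (f x) (f (σ x)) (f y) (f (σ y))
      (same (mul_nonneg_of_nonpos_of_nonpos (by linarith) (by linarith)))
    linarith

end Energy

/-! ### A compact class of continuous functions. -/

section Compactness

variable {E : Type*} [NormedAddCommGroup E]

/-- Continuous functions with values in `[0, M]`, vanishing off the ball of radius `R`, and with a
modulus of continuity at least as good as that of `f`. -/
def modulusClass (f : E → ℝ) (R M : ℝ) : Set C(E, ℝ) :=
  {h | (∀ z, h z ∈ Set.Icc 0 M) ∧ (∀ z, R ≤ ‖z‖ → h z = 0) ∧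
    ∀ δ ε : ℝ, (∀ x y, ‖x - y‖ ≤ δ → |f x - f y| ≤ ε) → ∀ x y, ‖x - y‖ ≤ δ → |h x - h y| ≤ ε}

theorem isCompact_modulusClass {f : E → ℝ} (hf : UniformContinuous f) (R M : ℝ) :
    IsCompact (modulusClass f R M) := by
  have hmod : ∀ ε > 0, ∃ δ > 0, ∀ x y, ‖x - y‖ ≤ δ → |f x - f y| ≤ ε := fun ε hε => by
    obtain ⟨δ, hδ, h⟩ := Metric.uniformContinuous_iff.1 hf ε hε
    refine ⟨δ / 2, half_pos hδ, fun x y hxy => ?_⟩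
    rw [← Real.dist_eq]
    exact (h (by rw [dist_eq_norm]; linarith)).le
  refine ArzelaAscoli.isCompact_of_equicontinuous _ ?_ ?_
  · have himg : ContinuousMap.toFun '' modulusClass f R M =
        Set.pi Set.univ (fun _ => Set.Icc 0 M) ∩ ({h : E → ℝ | (∀ z, R ≤ ‖z‖ → h z = 0) ∧
        ∀ δ ε : ℝ, (∀ x y, ‖x - y‖ ≤ δ → |f x - f y| ≤ ε) →
          ∀ x y, ‖x - y‖ ≤ δ → |h x - h y| ≤ ε}) := by
      ext h
      constructor
      · rintro ⟨g, hg, rfl⟩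
        exact ⟨fun z _ => hg.1 z, hg.2⟩
      · rintro ⟨h1, h2⟩
        have hc : Continuous h := by
          refine Metric.continuous_iff.2 fun b ε hε => ?_
          obtain ⟨δ, hδ, hm⟩ := hmod (ε / 2) (half_pos hε)
          refine ⟨δ, hδ, fun a hab => ?_⟩
          rw [dist_eq_norm] at hab
          rw [Real.dist_eq]
          linarith [h2.2 δ _ hm a b hab.le]
        exact ⟨⟨h, hc⟩, ⟨fun z => h1 z trivial, h2⟩, rfl⟩
    rw [himg]
    refine (isCompact_univ_pi fun _ => isCompact_Icc).inter_right ?_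
    simp only [Set.ofPred_and, Set.ofPred_forall]
    refine IsClosed.inter ?_ ?_
    · exact isClosed_iInter fun z => isClosed_iInter fun _ =>
        isClosed_eq (continuous_apply z) continuous_const
    · exact isClosed_iInter fun δ => isClosed_iInter fun ε => isClosed_iInter fun _ =>
        isClosed_iInter fun x => isClosed_iInter fun y => isClosed_iInter fun _ =>
          isClosed_le (by fun_prop) continuous_const
  · intro x
    rw [Metric.equicontinuousAt_iff]
    intro ε hε
    obtain ⟨δ, hδ, hm⟩ := hmod (ε / 2) (half_pos hε)
    refine ⟨δ, hδ, fun y hy h => ?_⟩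
    rw [dist_eq_norm, norm_sub_rev] at hy
    have := h.2.2.2 δ _ hm x y hy.le
    rw [Real.dist_eq]
    change |h.1 x - h.1 y| < ε
    linarith

theorem hasCompactSupport_of_forall_norm [ProperSpace E] {h : E → ℝ} {R : ℝ}
    (hR : ∀ z, R ≤ ‖z‖ → h z = 0) : HasCompactSupport h :=
  HasCompactSupport.intro (isCompact_closedBall 0 R) fun x hx => hR x (by
    rw [mem_closedBall_zero_iff, not_le] at hx
    exact hx.le)

theorem continuous_integral_modulusClass {F : Type*} [TopologicalSpace F] [MeasurableSpace F]
    [OpensMeasurableSpace F] {μ : Measure F} [IsLocallyFiniteMeasure μ] {f : E → ℝ}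
    (hf : UniformContinuous f) [ProperSpace E] {R M : ℝ} {K : Set F} (hK : IsCompact K)
    {G : C(E, ℝ) → F → ℝ} (hG : Continuous (Function.uncurry G))
    (h0 : ∀ h ∈ modulusClass f R M, ∀ y ∉ K, G h y = 0) :
    Continuous fun h : modulusClass f R M => ∫ y, G h y ∂μ := by
  have := isCompact_iff_compactSpace.1 (isCompact_modulusClass hf R M)
  have h1 : Continuous (Function.uncurry fun (h : modulusClass f R M) (y : F) => G h y) :=
    hG.comp (by fun_prop : Continuous fun p : modulusClass f R M × F => ((p.1 : C(E, ℝ)), p.2))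
  have h2 : (fun h : modulusClass f R M => ∫ y, G h y ∂μ) =
      fun h : modulusClass f R M => ∫ y in K, G h y ∂μ := by
    funext h
    exact (setIntegral_eq_integral_of_forall_compl_eq_zero (h0 h h.2)).symm
  rw [h2]
  exact continuous_parametric_integral_of_continuous h1 hK

end Compactness

/-! ### The extremal problem, equimeasurability and stability of the energy. -/

section Extremal

variable {E : Type*} [NormedAddCommGroup E] [InnerProductSpace ℝ E] [FiniteDimensional ℝ E]
  [MeasurableSpace E] [BorelSpace E] {ψ f g : E → ℝ}

/-- An equimeasurable radially nonincreasing function of larger Riesz energy, obtained by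
minimizing the second moment over a compact class stable under polarization. -/
theorem exists_radial_rieszEnergy_le (h : RadiallyAntitone ψ) (h0 : 0 ≤ ψ) (hψ : Continuous ψ)
    (hf : Continuous f) (hfs : HasCompactSupport f) (hf0 : 0 ≤ f) :
    ∃ g : E → ℝ, Continuous g ∧ HasCompactSupport g ∧ 0 ≤ g ∧
      (∀ x y, ‖x‖ < ‖y‖ → g y ≤ g x) ∧ rieszEnergy ψ f ≤ rieszEnergy ψ g ∧
      ∀ Φ : ℝ → ℝ, Continuous Φ → Φ 0 = 0 → ∫ z, Φ (g z) = ∫ z, Φ (f z) := by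
  have huc : UniformContinuous f := hf.uniformContinuous_of_tendsto_cocompact
    (hfs.is_zero_at_infty)
  obtain ⟨R, hR⟩ : ∃ R, ∀ z, R ≤ ‖z‖ → f z = 0 := by
    obtain ⟨R, hR⟩ := hfs.isCompact.isBounded.exists_norm_le
    refine ⟨R + 1, fun z hz => image_eq_zero_of_notMem_tsupport fun hz' => ?_⟩
    linarith [hR z hz']
  obtain ⟨M, hM⟩ : ∃ M, ∀ z, f z ≤ M := by
    obtain ⟨M, hM⟩ := hf.bounded_above_of_compact_support hfs
    exact ⟨M, fun z => (le_abs_self _).trans (hM z)⟩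
  set S := modulusClass f R M with hS
  have hcs : ∀ k : S, HasCompactSupport (k : C(E, ℝ)) := fun k =>
    hasCompactSupport_of_forall_norm k.2.2.1
  have hint : ∀ k : S, Integrable (k : C(E, ℝ)) := fun k =>
    k.1.continuous.integrable_of_hasCompactSupport (hcs k)
  have hK : IsCompact (Metric.closedBall (0 : E) R) := isCompact_closedBall 0 R
  have hout : ∀ k ∈ S, ∀ y ∉ Metric.closedBall (0 : E) R, k y = 0 := fun k hk y hy =>
    hk.2.1 y (by rw [mem_closedBall_zero_iff, not_le] at hy; exact hy.le)
  have c1 : Continuous fun k : S => rieszEnergy ψ (k : C(E, ℝ)) := by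
    refine continuous_integral_modulusClass huc (hK.prod hK)
      (G := fun k p => ψ (p.1 - p.2) * (k p.1 * k p.2)) ?_ fun k hk y hy => ?_
    · simp only [Function.uncurry_def]
      fun_prop
    · rw [Set.mem_prod, not_and_or] at hy
      rcases hy with hy | hy <;> simp [hout k hk _ hy]
  have c2 : ∀ Φ : ℝ → ℝ, Continuous Φ → Φ 0 = 0 →
      Continuous fun k : S => ∫ z, Φ ((k : C(E, ℝ)) z) := fun Φ hΦ hΦ0 => by
    refine continuous_integral_modulusClass huc hK (G := fun k z => Φ (k z)) ?_
      fun k hk y hy => ?_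
    · simp only [Function.uncurry_def]
      fun_prop
    · simp [hout k hk _ hy, hΦ0]
  have c3 : Continuous fun k : S => ∫ z, ‖z‖ ^ 2 * (k : C(E, ℝ)) z := by
    refine continuous_integral_modulusClass huc hK (G := fun k z => ‖z‖ ^ 2 * k z) ?_
      fun k hk y hy => ?_
    · simp only [Function.uncurry_def]
      fun_prop
    · simp [hout k hk _ hy]
  have hcompact : CompactSpace S := isCompact_iff_compactSpace.1 (isCompact_modulusClass huc R M)
  -- Equimeasurability is encoded by integrals of continuous functions of the values, so that it is
  -- a closed condition.
  set A : Set S := {k | rieszEnergy ψ f ≤ rieszEnergy ψ (k : C(E, ℝ)) ∧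
    ∀ Φ : ℝ → ℝ, Continuous Φ → Φ 0 = 0 → ∫ z, Φ ((k : C(E, ℝ)) z) = ∫ z, Φ (f z)} with hA
  have hAc : IsCompact A := by
    refine IsClosed.isCompact ?_
    simp only [hA, Set.ofPred_and, Set.ofPred_forall]
    exact (isClosed_le continuous_const c1).inter (isClosed_iInter fun Φ => isClosed_iInter fun h1 =>
      isClosed_iInter fun h2 => isClosed_eq (c2 Φ h1 h2) continuous_const)
  have hfS : (⟨f, hf⟩ : C(E, ℝ)) ∈ S := ⟨fun z => ⟨hf0 z, hM z⟩, hR, fun _ _ h => h⟩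
  obtain ⟨k, hkA, hmin⟩ := hAc.exists_isMinOn (⟨⟨_, hfS⟩, le_rfl, fun _ _ _ => rfl⟩ : A.Nonempty)
    c3.continuousOn
  refine ⟨k.1, k.1.continuous, hcs k, fun z => (k.2.1 z).1, fun x y hxy => ?_, hkA⟩
  by_contra! hlt
  have hne : 0 < ‖y - x‖ := norm_pos_iff.2 (sub_ne_zero.2 (by rintro rfl; exact lt_irrefl _ hxy))
  -- The perpendicular bisector of `x` and `y`: its reflection takes `x` to `y`, and `c > 0` because
  -- `x` is nearer to the origin. Polarizing there stays in `A` and lowers the second moment.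
  set u : E := ‖y - x‖⁻¹ • (y - x) with hu'
  set c : ℝ := (‖y‖ ^ 2 - ‖x‖ ^ 2) / (2 * ‖y - x‖) with hc'
  have hu : ‖u‖ = 1 := by
    rw [hu', norm_smul, norm_inv, norm_norm, inv_mul_cancel₀ hne.ne']
  have hsq : ‖x‖ ^ 2 < ‖y‖ ^ 2 := by
    have := norm_nonneg x
    gcongr
  have hc : 0 < c := div_pos (by linarith) (by positivity)
  have hdiff : c - inner ℝ u x = ‖y - x‖ / 2 := by
    rw [hu', real_inner_smul_left, inner_sub_left, real_inner_self_eq_norm_sq, hc']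
    have := norm_sub_sq_real y x
    field_simp
    linarith
  have hrefl : hyperplaneReflection u c x = y := by
    rw [hyperplaneReflection, hdiff, mul_div_cancel₀ _ two_ne_zero, hu', smul_smul,
      mul_inv_cancel₀ hne.ne', one_smul, add_sub_cancel]
  have hpm := fun δ ε (hm : ∀ x y : E, ‖x - y‖ ≤ δ → |f x - f y| ≤ ε) =>
    polarization_modulus hu (c := c) (k.2.2.2 δ ε hm)
  have hpc : Continuous (polarization u c k.1) := by
    refine Metric.continuous_iff.2 fun b ε hε => ?_
    obtain ⟨δ, hδ, hm⟩ := Metric.uniformContinuous_iff.1 huc (ε / 2) (half_pos hε)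
    refine ⟨δ / 2, half_pos hδ, fun a hab => ?_⟩
    rw [dist_eq_norm] at hab
    rw [Real.dist_eq]
    have := hpm (δ / 2) (ε / 2) (fun x y hxy => by
      rw [← Real.dist_eq]
      exact (hm (by rw [dist_eq_norm]; linarith)).le) a b hab.le
    linarith
  let p : S := ⟨⟨_, hpc⟩, polarization_mem_Icc hu k.2.1,
    fun z hz => polarization_eq_zero hu hc.le (fun z => (k.2.1 z).1) k.2.2.1 hz, hpm⟩
  have hpA : p ∈ A := by
    refine ⟨hkA.1.trans (rieszEnergy_le_polarization h h0 hψ hu (hint k) (hint p)),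
      fun Φ hΦ hΦ0 => (integral_comp_polarization hu (c := c) ?_ ?_).trans (hkA.2 Φ hΦ hΦ0)⟩
    · exact (hΦ.comp k.1.continuous).integrable_of_hasCompactSupport ((hcs k).comp_left hΦ0)
    · exact (hΦ.comp p.1.continuous).integrable_of_hasCompactSupport ((hcs p).comp_left hΦ0)
  have hlt' := integral_norm_sq_mul_polarization_lt hu hc k.1.continuous hpc (hcs k) (hcs p) (x := x)
    (by linarith) (by rw [hrefl]; exact hlt)
  exact absurd (hmin hpA) (not_le.2 hlt')

theorem volume_superlevel_eq_of_integral_comp_eq (hf : Integrable f) (hg : Integrable g)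
    (hf0 : 0 ≤ f) (hg0 : 0 ≤ g) (hfm : Measurable f) (hgm : Measurable g)
    (h : ∀ Φ : ℝ → ℝ, Continuous Φ → Φ 0 = 0 → ∫ z, Φ (g z) = ∫ z, Φ (f z)) {t : ℝ} (ht : 0 < t) :
    volume {z | t < g z} = volume {z | t < f z} := by
  -- Continuous functions tending to the indicator of `(t, ∞)` and vanishing on `(-∞, t]`; composed
  -- with `k` they are dominated by `k / t`.
  set Φ : ℕ → ℝ → ℝ := fun n s => min 1 (n * max (s - t) 0) with hΦ
  have hΦc : ∀ n, Continuous (Φ n) := fun n => by fun_prop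
  have hΦ0 : ∀ n, Φ n 0 = 0 := fun n => by
    simp [hΦ, max_eq_right (by linarith : -t ≤ 0)]
  have hlim : ∀ k : E → ℝ, Integrable k → 0 ≤ k → Measurable k →
      Filter.Tendsto (fun n => ∫ z, Φ n (k z)) Filter.atTop
        (nhds (volume.real {z | t < k z})) := fun k hk hk0 hkm => by
    rw [← integral_indicator_one (measurableSet_lt measurable_const hkm)]
    refine tendsto_integral_of_dominated_convergence (fun z => k z / t)
      (fun n => ((hΦc n).measurable.comp hkm).aestronglyMeasurable) (hk.div_const t)
      (fun n => ae_of_all _ fun z => ?_) (ae_of_all _ fun z => ?_)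
    · have hkz := hk0 z
      rw [Real.norm_of_nonneg (le_min zero_le_one (by positivity))]
      rcases le_or_gt (k z) t with hz | hz
      · simp only [max_eq_right (by linarith : k z - t ≤ 0), mul_zero]
        rw [min_eq_right zero_le_one]
        exact div_nonneg hkz ht.le
      · exact (min_le_left _ _).trans ((one_le_div ht).2 hz.le)
    · by_cases hz : t < k z
      · rw [Set.indicator_of_mem (by exact hz)]
        refine tendsto_const_nhds.congr' ?_
        obtain ⟨N, hN⟩ := exists_nat_ge (k z - t)⁻¹
        filter_upwards [Filter.eventually_ge_atTop N] with n hn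
        have hpos : 0 < k z - t := by linarith
        simp only [hΦ, max_eq_left hpos.le]
        rw [min_eq_left, Pi.one_apply]
        calc 1 = (k z - t)⁻¹ * (k z - t) := (inv_mul_cancel₀ hpos.ne').symm
          _ ≤ n * (k z - t) := by
            gcongr
            exact hN.trans (by exact_mod_cast hn)
      · rw [Set.indicator_of_notMem (by exact hz)]
        simp only [hΦ, max_eq_right (by linarith : k z - t ≤ 0), mul_zero]
        simp
  have heq := tendsto_nhds_unique (hlim g hg hg0 hgm)
    ((hlim f hf hf0 hfm).congr fun n => (h _ (hΦc n) (hΦ0 n)).symm)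
  have hfin : ∀ k : E → ℝ, Integrable k → 0 ≤ k → volume {z | t < k z} ≠ ∞ := fun k hk hk0 => by
    have := (hk.measure_norm_gt_lt_top ht).ne
    simpa only [Real.norm_of_nonneg (hk0 _)] using this
  exact (ENNReal.toReal_eq_toReal_iff' (hfin g hg hg0) (hfin f hf hf0)).1 heq

theorem abs_rieszEnergy_sub_le (h : RadiallyAntitone ψ) (h0 : 0 ≤ ψ) (hψ : Continuous ψ)
    (hf : Integrable f) (hg : Integrable g) :
    |rieszEnergy ψ f - rieszEnergy ψ g| ≤
      ψ 0 * (((∫ x, |f x|) + ∫ x, |g x|) * ∫ x, |f x - g x|) := by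
  have hs : Integrable fun x => |f x - g x| := (hf.sub hg).abs
  have e : rieszEnergy ψ f - rieszEnergy ψ g =
      ∫ p : E × E, (ψ (p.1 - p.2) * (f p.1 * f p.2) - ψ (p.1 - p.2) * (g p.1 * g p.2)) :=
    (integral_sub (integrable_rieszEnergy h h0 hψ hf hf)
      (integrable_rieszEnergy h h0 hψ hg hg)).symm
  have i1 := hf.abs.mul_prod hs (μ := volume) (ν := volume)
  have i2 := hs.mul_prod hg.abs (μ := volume) (ν := volume)
  rw [e, ← Real.norm_eq_abs]
  calc _ ≤ ∫ p : E × E, ψ 0 * (|f p.1| * |f p.2 - g p.2| + |f p.1 - g p.1| * |g p.2|) := by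
        refine norm_integral_le_of_norm_le ((i1.add i2).const_mul _) (ae_of_all _ fun p => ?_)
        rw [← mul_sub, norm_mul]
        refine mul_le_mul (h.norm_le h0 _) ?_ (norm_nonneg _) (h0 0)
        rw [show f p.1 * f p.2 - g p.1 * g p.2 =
          f p.1 * (f p.2 - g p.2) + (f p.1 - g p.1) * g p.2 by ring, ← abs_mul, ← abs_mul]
        exact abs_add_le _ _
    _ = _ := by
        rw [integral_const_mul]
        congr 1
        have e1 := integral_prod_mul (μ := volume) (ν := volume) (fun x => |f x|)
          fun x => |f x - g x|
        have e2 := integral_prod_mul (μ := volume) (ν := volume) (fun x => |f x - g x|)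
          fun x => |g x|
        rw [Measure.volume_eq_prod, integral_add i1 i2, e1, e2]
        ring

end Extremal

/-! ### Riesz' rearrangement inequality. -/

section Riesz

variable {d : ℕ} {ψ : EuclideanSpace ℝ (Fin d) → ℝ} {φ : EuclideanSpace ℝ (Fin d) → ℂ}

/-- The radial extremal has the distribution function of `‖φ‖`, hence the same rearrangement, and it
coincides a.e. with its own rearrangement. -/
theorem rieszEnergy_le_symmRearr_of_continuous (hd : 1 ≤ d) (h : RadiallyAntitone ψ) (h0 : 0 ≤ ψ)
    (hψ : Continuous ψ) (hφ : Continuous φ) (hφs : HasCompactSupport φ) :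
    rieszEnergy ψ (fun x => ‖φ x‖) ≤ rieszEnergy ψ (symmRearr φ) := by
  obtain ⟨g, hgc, hgs, hg0, hgr, hJ, hΦ⟩ := exists_radial_rieszEnergy_le h h0 hψ hφ.norm hφs.norm
    fun x => norm_nonneg _
  have hgi := hgc.integrable_of_hasCompactSupport (μ := volume) hgs
  have hng : ∀ x, ‖(g x : ℂ)‖ = g x := fun x => by
    rw [Complex.norm_real, Real.norm_of_nonneg (hg0 x)]
  have hvol := fun t ht => volume_superlevel_eq_of_integral_comp_eq
    (hφ.norm.integrable_of_hasCompactSupport (μ := volume) hφs.norm) hgi (fun x => norm_nonneg _) hg0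
    hφ.norm.measurable hgc.measurable hΦ (t := t) ht
  have h1 : symmRearr φ = symmRearr fun x => (g x : ℂ) :=
    symmRearr_congr_volume fun t ht => by simp only [hng, hvol t ht]
  have h2 : symmRearr φ =ᵐ[volume] g := by
    rw [h1]
    refine (symmRearr_ae_eq_norm (φ := fun x => (g x : ℂ)) hd
      (Complex.measurable_ofReal.comp hgc.measurable) hgi.ofReal
      fun x y hxy => ?_).trans (ae_of_all _ hng)
    rw [hng, hng]
    exact hgr x y hxy
  refine hJ.trans (le_of_eq (integral_congr_ae ?_))
  have e1 := Measure.quasiMeasurePreserving_fst (μ := volume)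
    (ν := (volume : Measure (EuclideanSpace ℝ (Fin d)))) |>.ae_eq_comp h2
  have e2 := Measure.quasiMeasurePreserving_snd (ν := volume)
    (μ := (volume : Measure (EuclideanSpace ℝ (Fin d)))) |>.ae_eq_comp h2
  filter_upwards [e1, e2] with p h3 h4
  simp only [Function.comp_apply] at h3 h4
  rw [h3, h4]

/-- **Riesz' rearrangement inequality** for a radially nonincreasing kernel. -/
theorem rieszEnergy_le_symmRearr (hd : 1 ≤ d) (h : RadiallyAntitone ψ) (h0 : 0 ≤ ψ)
    (hψ : Continuous ψ) (hφ : Integrable φ) :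
    rieszEnergy ψ (fun x => ‖φ x‖) ≤ rieszEnergy ψ (symmRearr φ) := by
  wlog hm : Measurable φ generalizing φ
  · rw [symmRearr_congr_ae hφ.1.ae_eq_mk]
    refine le_trans (le_of_eq (integral_congr_ae ?_)) (this (hφ.congr hφ.1.ae_eq_mk)
      hφ.1.stronglyMeasurable_mk.measurable)
    have e1 := Measure.quasiMeasurePreserving_fst (μ := volume)
      (ν := (volume : Measure (EuclideanSpace ℝ (Fin d)))) |>.ae_eq_comp hφ.1.ae_eq_mk
    have e2 := Measure.quasiMeasurePreserving_snd (ν := volume)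
      (μ := (volume : Measure (EuclideanSpace ℝ (Fin d)))) |>.ae_eq_comp hφ.1.ae_eq_mk
    filter_upwards [e1, e2] with p h3 h4
    simp only [Function.comp_apply] at h3 h4
    simp only [← h3, ← h4]
  have hφ' := integrable_symmRearr hd hφ
  set C := (∫ x, |‖φ x‖|) + ∫ x, |symmRearr φ x| with hC
  -- Approximate `φ` in `L¹` by a continuous compactly supported `χ`. Both energies move by `O(ε)`,
  -- the right one because rearrangement contracts `L¹`.
  have key : ∀ ε > 0, rieszEnergy ψ (fun x => ‖φ x‖) ≤
      rieszEnergy ψ (symmRearr φ) + ψ 0 * (2 * C + 2 * ε) * ε := fun ε hε => by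
    obtain ⟨χ, hχs, hχε, hχc, hχi⟩ := hφ.exists_hasCompactSupport_integral_sub_le hε
    have hχ' := integrable_symmRearr hd hχi
    have d1 : ∫ x, |‖φ x‖ - ‖χ x‖| ≤ ε :=
      (integral_mono (hφ.norm.sub hχi.norm).abs (hφ.sub hχi).norm
        fun x => abs_norm_sub_norm_le _ _).trans hχε
    have d2 : ∫ x, |symmRearr φ x - symmRearr χ x| ≤ ε :=
      (integral_abs_symmRearr_sub_le hd hm hφ hχc.measurable hχi).trans d1
    have tri : ∀ {f g : EuclideanSpace ℝ (Fin d) → ℝ}, Integrable f → Integrable g →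
        ∫ x, |g x| ≤ (∫ x, |f x|) + ∫ x, |f x - g x| := fun {f g} hf hg => by
      have hs : Integrable fun x => |f x - g x| := (hf.sub hg).abs
      rw [← integral_add hf.abs hs]
      refine integral_mono hg.abs (hf.abs.add hs) fun x => ?_
      dsimp only
      have := abs_sub_abs_le_abs_sub (g x) (f x)
      rw [abs_sub_comm] at this
      linarith
    have b1 := abs_rieszEnergy_sub_le h h0 hψ hφ.norm hχi.norm
    have b2 := abs_rieszEnergy_sub_le h h0 hψ hφ' hχ'
    have t1 := tri hφ.norm hχi.norm
    have t2 := tri hφ' hχ'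
    have p1 : 0 ≤ ∫ x, |‖φ x‖| := integral_nonneg fun _ => abs_nonneg _
    have p2 : 0 ≤ ∫ x, |symmRearr φ x| := integral_nonneg fun _ => abs_nonneg _
    have p3 : 0 ≤ ∫ x, |‖φ x‖ - ‖χ x‖| := integral_nonneg fun _ => abs_nonneg _
    have p4 : 0 ≤ ∫ x, |symmRearr φ x - symmRearr χ x| := integral_nonneg fun _ => abs_nonneg _
    have hJ := rieszEnergy_le_symmRearr_of_continuous hd h h0 hψ hχc hχs
    have u1 : ψ 0 * (((∫ x, |‖φ x‖|) + ∫ x, |‖χ x‖|) * ∫ x, |‖φ x‖ - ‖χ x‖|) ≤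
        ψ 0 * ((2 * (∫ x, |‖φ x‖|) + ε) * ε) := by
      refine mul_le_mul_of_nonneg_left ?_ (h0 0)
      refine mul_le_mul (by linarith) d1 p3 (by linarith)
    have u2 : ψ 0 * (((∫ x, |symmRearr φ x|) + ∫ x, |symmRearr χ x|) *
        ∫ x, |symmRearr φ x - symmRearr χ x|) ≤
        ψ 0 * ((2 * (∫ x, |symmRearr φ x|) + ε) * ε) := by
      refine mul_le_mul_of_nonneg_left ?_ (h0 0)
      refine mul_le_mul (by linarith) d2 p4 (by linarith)
    have v1 := (le_abs_self _).trans (b1.trans u1)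
    have v2 := (neg_le_abs _).trans (b2.trans u2)
    have : ψ 0 * (2 * C + 2 * ε) * ε = ψ 0 * ((2 * (∫ x, |‖φ x‖|) + ε) * ε) +
        ψ 0 * ((2 * (∫ x, |symmRearr φ x|) + ε) * ε) := by rw [hC]; ring
    linarith
  have hlim : Filter.Tendsto
      (fun ε : ℝ => rieszEnergy ψ (symmRearr φ) + ψ 0 * (2 * C + 2 * ε) * ε)
      (nhdsWithin 0 (Set.Ioi 0)) (nhds (rieszEnergy ψ (symmRearr φ))) := by
    have : Continuous fun ε : ℝ => rieszEnergy ψ (symmRearr φ) + ψ 0 * (2 * C + 2 * ε) * ε := by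
      fun_prop
    simpa using (this.tendsto 0).mono_left nhdsWithin_le_nhds
  exact ge_of_tendsto hlim (Filter.eventually_of_mem self_mem_nhdsWithin key)

end Riesz

/-! ### Fourier identities for the rescaled weight. -/

section Weight

variable {d : ℕ} {α Ω : ℝ}

theorem integrable_bochnerRieszWeight (hd : 1 ≤ d) (hα : -1 < α) (hΩ : 0 < Ω) :
    Integrable (bochnerRieszWeight d α Ω) :=
  ((integrable_bochnerRiesz hd hα).comp_smul (inv_ne_zero hΩ.ne')).const_mul _

theorem fourier_bochnerRieszWeight (hd : 1 ≤ d) (hα : -1 < α) (hΩ : 0 < Ω)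
    (t : EuclideanSpace ℝ (Fin d)) :
    𝓕 (fun ξ => (bochnerRieszWeight d α Ω ξ : ℂ)) t = bochnerRieszKernel d α (Ω • t) := by
  rw [← fourier_bochnerRiesz hd hα, Real.fourier_eq', Real.fourier_eq']
  have h := Measure.integral_comp_inv_smul (volume : Measure (EuclideanSpace ℝ (Fin d)))
    (fun v => Complex.exp (↑(-2 * Real.pi * inner ℝ v (Ω • t)) * Complex.I) •
      (bochnerRiesz d α v : ℂ)) Ω
  have hpow : (0 : ℝ) < Ω ^ d := by positivity
  rw [finrank_euclideanSpace_fin, abs_of_pos hpow] at h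
  rw [← inv_smul_eq_iff₀ hpow.ne'] at h
  rw [← h, ← integral_smul]
  refine integral_congr_ae (ae_of_all _ fun v => ?_)
  simp only [bochnerRieszWeight, real_inner_smul_left, real_inner_smul_right, smul_eq_mul,
    Complex.real_smul]
  rw [mul_inv_cancel_left₀ hΩ.ne']
  push_cast
  ring

theorem continuous_fourier {f : EuclideanSpace ℝ (Fin d) → ℂ} (hf : Integrable f) :
    Continuous (𝓕 f) :=
  VectorFourier.fourierIntegral_continuous Real.continuous_fourierChar
    (by exact continuous_inner) hf

theorem integrable_bochnerRieszWeight_mul_fourier_sq (hd : 1 ≤ d) (hα : -1 < α) (hΩ : 0 < Ω)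
    {f : EuclideanSpace ℝ (Fin d) → ℂ} (hf : Integrable f) :
    Integrable fun ξ => bochnerRieszWeight d α Ω ξ * ‖𝓕 f ξ‖ ^ 2 := by
  refine (integrable_bochnerRieszWeight hd hα hΩ).mul_bdd (c := (∫ v, ‖f v‖) ^ 2)
    ((continuous_fourier hf).norm.pow 2).aestronglyMeasurable (ae_of_all _ fun ξ => ?_)
  rw [norm_pow, norm_norm]
  gcongr
  exact VectorFourier.norm_fourierIntegral_le_integral_norm _ _ _ f ξ

theorem integral_bochnerRieszWeight_mul_fourier (hd : 1 ≤ d) (hα : -1 < α) (hΩ : 0 < Ω)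
    {f : EuclideanSpace ℝ (Fin d) → ℂ} (hf : Integrable f) :
    ∫ ξ, (bochnerRieszWeight d α Ω ξ : ℂ) * 𝓕 f ξ =
      ∫ x, (bochnerRieszKernel d α (Ω • x) : ℂ) * f x := by
  have h := VectorFourier.integral_fourierIntegral_smul_eq_flip (L := innerₗ _)
    Real.continuous_fourierChar (by exact continuous_inner)
    (integrable_bochnerRieszWeight hd hα hΩ).ofReal hf
  rw [flip_innerₗ] at h
  refine Eq.trans ?_ (h.symm.trans ?_)
  · rfl
  · refine integral_congr_ae (ae_of_all _ fun x => ?_)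
    exact congrArg (· * f x) (fourier_bochnerRieszWeight hd hα hΩ x)

/-- Write `|f̂|²` as a double integral and apply Fubini: the `ξ`-integral of the weight against the
character of `x - y` is the kernel. -/
theorem integral_bochnerRieszWeight_mul_fourier_sq (hd : 1 ≤ d) (hα : -1 < α) (hΩ : 0 < Ω)
    {f : EuclideanSpace ℝ (Fin d) → ℂ} (hf : Integrable f) :
    ((∫ ξ, bochnerRieszWeight d α Ω ξ * ‖𝓕 f ξ‖ ^ 2 : ℝ) : ℂ) =
      ∫ p : EuclideanSpace ℝ (Fin d) × EuclideanSpace ℝ (Fin d),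
        (bochnerRieszKernel d α (Ω • (p.1 - p.2)) : ℂ) *
          (f p.1 * (starRingEnd ℂ) (f p.2)) := by
  set e : EuclideanSpace ℝ (Fin d) → EuclideanSpace ℝ (Fin d) → ℂ := fun v ξ =>
    Complex.exp (↑(-2 * Real.pi * inner ℝ v ξ) * Complex.I) with he
  have hfc : Integrable fun x => (starRingEnd ℂ) (f x) :=
    (Complex.conjLIE.integrable_comp_iff (φ := f)).2 hf
  have hff := hf.mul_prod hfc
  rw [← Measure.volume_eq_prod] at hff
  have hw : Integrable fun ξ => (bochnerRieszWeight d α Ω ξ : ℂ) :=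
    (integrable_bochnerRieszWeight hd hα hΩ).ofReal
  have hI : Integrable (Function.uncurry fun (ξ : EuclideanSpace ℝ (Fin d))
      (p : EuclideanSpace ℝ (Fin d) × EuclideanSpace ℝ (Fin d)) =>
      e (p.1 - p.2) ξ * ((bochnerRieszWeight d α Ω ξ : ℂ) *
        (f p.1 * (starRingEnd ℂ) (f p.2)))) (volume.prod volume) := by
    refine (hw.mul_prod hff).bdd_mul (c := 1) ?_ (ae_of_all _ fun q => ?_)
    · exact (by fun_prop : Continuous fun q : EuclideanSpace ℝ (Fin d) ×
        (EuclideanSpace ℝ (Fin d) × EuclideanSpace ℝ (Fin d)) =>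
        e (q.2.1 - q.2.2) q.1).aestronglyMeasurable
    · rw [he, Complex.norm_exp_ofReal_mul_I]
  have hsplit : ∀ ξ, (bochnerRieszWeight d α Ω ξ : ℂ) * (‖𝓕 f ξ‖ : ℂ) ^ 2 =
      ∫ p : EuclideanSpace ℝ (Fin d) × EuclideanSpace ℝ (Fin d),
        e (p.1 - p.2) ξ * ((bochnerRieszWeight d α Ω ξ : ℂ) *
          (f p.1 * (starRingEnd ℂ) (f p.2))) := fun ξ => by
    rw [← Complex.mul_conj', Real.fourier_eq', ← integral_conj, ← integral_prod_mul,
      ← integral_const_mul, Measure.volume_eq_prod]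
    refine integral_congr_ae (ae_of_all _ fun p => ?_)
    simp only [he, smul_eq_mul, map_mul, ← Complex.exp_conj, Complex.conj_ofReal, Complex.conj_I,
      inner_sub_left]
    rw [show ((-2 * Real.pi * (inner ℝ p.1 ξ - inner ℝ p.2 ξ) : ℝ) : ℂ) * Complex.I =
      ((-2 * Real.pi * inner ℝ p.1 ξ : ℝ) : ℂ) * Complex.I +
        ((-2 * Real.pi * inner ℝ p.2 ξ : ℝ) : ℂ) * -Complex.I by push_cast; ring, Complex.exp_add]
    ring
  rw [← integral_complex_ofReal]
  push_cast
  simp_rw [hsplit]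
  rw [integral_integral_swap hI]
  refine integral_congr_ae (ae_of_all _ fun p => ?_)
  simp only
  rw [← fourier_bochnerRieszWeight hd hα hΩ, Real.fourier_eq', ← integral_mul_const]
  refine integral_congr_ae (ae_of_all _ fun ξ => ?_)
  simp only [he, smul_eq_mul, real_inner_comm, mul_assoc]

end Weight

/-! ### The radially nonincreasing majorant. -/

section Majorant

variable {d : ℕ} {k : EuclideanSpace ℝ (Fin d) → ℝ} {ρ : ℝ}

theorem RadiallyDominant.exists_majorant (hd : 1 ≤ d) (hρ : 0 ≤ ρ) (hk : Continuous k)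
    (h : RadiallyDominant k ρ) :
    ∃ ψ : EuclideanSpace ℝ (Fin d) → ℝ, Continuous ψ ∧ RadiallyAntitone ψ ∧ 0 ≤ ψ ∧
      (∀ x, |k x| ≤ ψ x) ∧ ∀ x, ‖x‖ ≤ ρ → ψ x = k x := by
  obtain ⟨e, he⟩ := exists_norm_eq_of_nonneg hd zero_le_one
  have hn : ∀ x : EuclideanSpace ℝ (Fin d), ‖min ‖x‖ ρ • e‖ = min ‖x‖ ρ := fun x => by
    rw [norm_smul, he, mul_one, Real.norm_of_nonneg (le_min (norm_nonneg _) hρ)]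
  have hdom : ∀ x y : EuclideanSpace ℝ (Fin d), ‖x‖ ≤ ‖y‖ → |k y| ≤ k (min ‖x‖ ρ • e) :=
    fun x y hxy => h _ _ (by rw [hn]; exact (min_le_left _ _).trans hxy)
      (by rw [hn]; exact min_le_right _ _)
  -- The radial profile of `k` along `e`, frozen at radius `ρ`. Dominance also makes `k` radial
  -- within `ρ`, so this agrees with `k` there.
  refine ⟨fun x => k (min ‖x‖ ρ • e), by fun_prop, fun x y hxy => ?_, fun x => ?_,
    fun x => hdom x x le_rfl, fun x hx => ?_⟩
  · refine (le_abs_self _).trans (h _ _ ?_ ?_) <;> rw [hn]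
    · rw [hn]
      exact min_le_min_right _ hxy
    · exact min_le_right _ _
  · exact (abs_nonneg _).trans (hdom x x le_rfl)
  · refine le_antisymm ((le_abs_self _).trans (h _ _ ?_ hx))
      ((le_abs_self _).trans (hdom x x le_rfl))
    rw [hn, min_eq_left hx]

theorem RadiallyAntitone.comp_smul {ψ : EuclideanSpace ℝ (Fin d) → ℝ} (h : RadiallyAntitone ψ)
    (Ω : ℝ) : RadiallyAntitone fun x => ψ (Ω • x) := fun x y hxy => h _ _ (by
  rw [norm_smul, norm_smul]
  gcongr)

theorem symmRearrRadius_eq_div (E : Set (EuclideanSpace ℝ (Fin d))) :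
    symmRearrRadius E = (volume E).toReal ^ (1 / (d : ℝ)) /
      (volume (Metric.ball (0 : EuclideanSpace ℝ (Fin d)) 1)).toReal ^ (1 / (d : ℝ)) := by
  rw [symmRearrRadius, ENNReal.toReal_div,
    Real.div_rpow ENNReal.toReal_nonneg ENNReal.toReal_nonneg]

theorem unitBall_rpow_pos :
    0 < (volume (Metric.ball (0 : EuclideanSpace ℝ (Fin d)) 1)).toReal ^ (1 / (d : ℝ)) :=
  Real.rpow_pos_of_pos (ENNReal.toReal_pos volume_unitBall_ne_zero volume_unitBall_ne_top) _

end Majorant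

/-! ### Donoho-Stark constants correspond to radii of dominance. -/

section Constants

variable {d : ℕ} {α : ℝ}

/-- Hardy-Littlewood for the majorant; the constant is such that `Ω` times the radius of the ball
carrying `|φ|^*` is at most `ρ`, where the majorant is the kernel itself. -/
theorem RadiallyDominant.isDonohoStarkConstant (hd : 1 ≤ d) (hα : -1 < α) {ρ : ℝ} (hρ : 0 < ρ)
    (h : RadiallyDominant (bochnerRieszKernel d α) ρ) :
    IsDonohoStarkConstant d α
      (ρ * (volume (Metric.ball (0 : EuclideanSpace ℝ (Fin d)) 1)).toReal ^ (1 / (d : ℝ))) := by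
  have hω := unitBall_rpow_pos (d := d)
  refine ⟨mul_pos hρ hω, fun Ω S hΩ hS hΩS φ hφ hsupp => ?_⟩
  have hkc := continuous_bochnerRieszKernel hd hα
  obtain ⟨ψ, hψc, hψa, hψ0, hkψ, hψk⟩ := h.exists_majorant hd hρ.le hkc
  have hφs := integrable_symmRearr hd hφ
  have hφc : Integrable fun x => (symmRearr φ x : ℂ) := hφs.ofReal
  have hsupp' : volume (Function.support φ) ≠ ∞ := (hsupp.trans_lt ENNReal.ofReal_lt_top).ne
  rw [integral_bochnerRieszWeight_mul_fourier hd hα hΩ hφ,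
    integral_bochnerRieszWeight_mul_fourier hd hα hΩ hφc]
  simp_rw [← Complex.ofReal_mul]
  rw [integral_complex_ofReal, Complex.ofReal_re]
  have hψΩ : Continuous fun x => ψ (Ω • x) := by fun_prop
  have hψΩa := hψa.comp_smul Ω
  have hi : Integrable fun x => ψ (Ω • x) * ‖φ x‖ :=
    hφ.norm.bdd_mul hψΩ.aestronglyMeasurable
      (ae_of_all _ fun x => hψΩa.norm_le (fun x => hψ0 (Ω • x)) x)
  calc ‖∫ x, (bochnerRieszKernel d α (Ω • x) : ℂ) * φ x‖ ≤ ∫ x, ψ (Ω • x) * ‖φ x‖ := by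
        refine norm_integral_le_of_norm_le hi (ae_of_all _ fun x => ?_)
        rw [norm_mul, Complex.norm_real]
        gcongr
        exact hkψ _
    _ ≤ ∫ x, ψ (Ω • x) * symmRearr φ x :=
        integral_mul_norm_le_integral_mul_symmRearr hd hφ hψΩa (fun x => hψ0 (Ω • x)) hψΩ
    _ = ∫ x, bochnerRieszKernel d α (Ω • x) * symmRearr φ x := by
        refine integral_congr_ae (ae_of_all _ fun x => ?_)
        dsimp only
        rcases le_or_gt (symmRearrRadius (Function.support φ)) ‖x‖ with hx | hx
        · rw [symmRearr_eq_zero hsupp' hx, mul_zero, mul_zero]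
        · rw [hψk]
          rw [norm_smul, Real.norm_of_nonneg hΩ.le]
          have h1 : (volume (Function.support φ)).toReal ^ (1 / (d : ℝ)) ≤ S ^ (1 / (d : ℝ)) :=
            Real.rpow_le_rpow ENNReal.toReal_nonneg
              (ENNReal.toReal_le_of_le_ofReal hS.le hsupp) (by positivity)
          rw [symmRearrRadius_eq_div] at hx
          rw [lt_div_iff₀ hω] at hx
          refine le_of_mul_le_mul_right ?_ hω
          calc _ = Ω * (‖x‖ * _) := mul_assoc _ _ _
            _ ≤ Ω * S ^ (1 / (d : ℝ)) := by gcongr; exact hx.le.trans h1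
            _ ≤ _ := hΩS

/-- Testing a Donoho-Stark constant on a ball with a small ball moved outwards. -/
theorem IsDonohoStarkConstant.setIntegral_le (hd : 1 ≤ d) (hα : -1 < α) {ϑ : ℝ}
    (h : IsDonohoStarkConstant d α ϑ) {t s : EuclideanSpace ℝ (Fin d)} {r ε l : ℝ} (hr : 0 < r)
    (hrϑ : r * (volume (Metric.ball (0 : EuclideanSpace ℝ (Fin d)) 1)).toReal ^ (1 / (d : ℝ)) ≤ ϑ)
    (ht : Metric.ball t ε ⊆ Metric.ball 0 r) (hs : Disjoint (Metric.ball s ε) (Metric.ball 0 r))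
    (hl : |l| = 1) :
    l * ∫ x in Metric.ball s ε, bochnerRieszKernel d α x ≤
      ∫ x in Metric.ball t ε, bochnerRieszKernel d α x := by
  have hkc := continuous_bochnerRieszKernel hd hα
  set A : Set (EuclideanSpace ℝ (Fin d)) := Metric.ball 0 r \ Metric.ball t ε with hA
  have hAm : MeasurableSet A := measurableSet_ball.diff measurableSet_ball
  have hBm : MeasurableSet (Metric.ball s ε) := measurableSet_ball
  have hAB : Disjoint A (Metric.ball s ε) := (hs.mono_right Set.sdiff_subset).symm
  have hvol : volume (A ∪ Metric.ball s ε) = volume (Metric.ball (0 : EuclideanSpace ℝ (Fin d)) r) := by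
    rw [measure_union hAB hBm, Measure.addHaar_ball_center volume s,
      ← Measure.addHaar_ball_center volume t, hA, measure_sdiff ht
      measurableSet_ball.nullMeasurableSet measure_ball_lt_top.ne,
      tsub_add_cancel_of_le (measure_mono ht)]
  -- The ball about `t` is cut out and put back about `s` with sign `l`. Then `|φ|` is the indicator
  -- of a set of the original volume, so it rearranges to that of the ball of radius `r`.
  set φ : EuclideanSpace ℝ (Fin d) → ℂ := fun x => A.indicator (fun _ => 1) x + (Metric.ball s ε).indicator
    (fun _ => (l : ℂ)) x with hφ
  set χ : EuclideanSpace ℝ (Fin d) → ℂ := (Metric.ball 0 r).indicator fun _ => 1 with hχ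
  have hφn : ∀ x, ‖φ x‖ = (A ∪ Metric.ball s ε).indicator (fun _ => (1 : ℝ)) x := fun x => by
    by_cases h1 : x ∈ A
    · have h2 : x ∉ Metric.ball s ε := Set.disjoint_left.1 hAB h1
      simp only [hφ, Set.indicator_of_mem h1, Set.indicator_of_notMem h2,
        Set.indicator_of_mem (Set.mem_union_left _ h1), add_zero, norm_one]
    · by_cases h2 : x ∈ Metric.ball s ε
      · simp only [hφ, Set.indicator_of_notMem h1, Set.indicator_of_mem h2,
          Set.indicator_of_mem (Set.mem_union_right _ h2), zero_add, Complex.norm_real,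
          Real.norm_eq_abs, hl]
      · simp only [hφ, Set.indicator_of_notMem h1, Set.indicator_of_notMem h2,
          Set.indicator_of_notMem (fun h => h.elim h1 h2 : x ∉ A ∪ Metric.ball s ε), zero_add,
          norm_zero]
  have hχn : ∀ x, ‖χ x‖ = (Metric.ball 0 r).indicator (fun _ => (1 : ℝ)) x := fun x => by
    by_cases h1 : x ∈ Metric.ball 0 r <;> simp [hχ, h1]
  have hχi : Integrable χ :=
    (integrable_indicator_iff measurableSet_ball).2 (integrableOn_const measure_ball_lt_top.ne)
  have hA1 : Integrable (A.indicator fun _ => (1 : ℂ)) := (integrable_indicator_iff hAm).2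
    (integrableOn_const (measure_ne_top_of_subset Set.sdiff_subset measure_ball_lt_top.ne))
  have hB1 : Integrable ((Metric.ball s ε).indicator fun _ => (l : ℂ)) :=
    (integrable_indicator_iff hBm).2 (integrableOn_const measure_ball_lt_top.ne)
  have hφi : Integrable φ := hA1.add hB1
  have hrearr : symmRearr φ =ᵐ[volume] fun x => ‖χ x‖ := by
    have : symmRearr φ = symmRearr χ := symmRearr_congr_volume fun τ hτ => by
      have key : ∀ F : Set (EuclideanSpace ℝ (Fin d)), volume {y | τ < F.indicator (fun _ => (1 : ℝ)) y} =
          if τ < 1 then volume F else 0 := fun F => by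
        split_ifs with h1
        · congr 1
          ext y
          by_cases hy : y ∈ F <;> simp [hy, h1, hτ.le]
        · convert measure_empty (μ := volume)
          ext y
          by_cases hy : y ∈ F <;> simp [hy, not_lt.1 h1, hτ.le]
      simp only [hφn, hχn, key, hvol]
    rw [this]
    refine symmRearr_ae_eq_norm hd (measurable_const.indicator measurableSet_ball) hχi
      fun x y hxy => ?_
    rw [hχn, hχn]
    by_cases hy : y ∈ Metric.ball (0 : EuclideanSpace ℝ (Fin d)) r
    · have hx : x ∈ Metric.ball (0 : EuclideanSpace ℝ (Fin d)) r := by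
        rw [mem_ball_zero_iff] at hy ⊢
        exact hxy.trans hy
      simp [hx, hy]
    · rw [Set.indicator_of_notMem hy]
      exact Set.indicator_nonneg (fun _ _ => zero_le_one) _
  have hω0 := ENNReal.toReal_pos (volume_unitBall_ne_zero (d := d)) volume_unitBall_ne_top
  have hd0 : d ≠ 0 := by omega
  have hsupp : volume (Function.support φ) ≤ ENNReal.ofReal
      (r ^ d * (volume (Metric.ball (0 : EuclideanSpace ℝ (Fin d)) 1)).toReal) := by
    rw [ENNReal.ofReal_mul (by positivity), ENNReal.ofReal_toReal volume_unitBall_ne_top,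
      ← volume_ball_eq hd (0 : EuclideanSpace ℝ (Fin d)) hr.le, ← hvol]
    refine measure_mono fun x hx => ?_
    by_contra hx'
    have := hφn x
    rw [Set.indicator_of_notMem hx', norm_eq_zero] at this
    exact hx this
  have hS : 1 * (r ^ d * (volume (Metric.ball (0 : EuclideanSpace ℝ (Fin d)) 1)).toReal) ^ (1 / (d : ℝ)) ≤ ϑ := by
    rw [one_mul, Real.mul_rpow (by positivity) hω0.le, one_div, Real.pow_rpow_inv_natCast hr.le hd0,
      ← one_div]
    exact hrϑ
  have main := h.2 1 _ one_pos (by positivity) hS φ hφi hsupp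
  have hφc : Integrable fun x => (symmRearr φ x : ℂ) := (integrable_symmRearr hd hφi).ofReal
  rw [integral_bochnerRieszWeight_mul_fourier hd hα one_pos hφi,
    integral_bochnerRieszWeight_mul_fourier hd hα one_pos hφc] at main
  simp_rw [← Complex.ofReal_mul, one_smul] at main
  rw [integral_complex_ofReal, Complex.ofReal_re] at main
  have hiball : ∀ x : EuclideanSpace ℝ (Fin d), IntegrableOn (bochnerRieszKernel d α) (Metric.ball x ε) := fun x =>
    (hkc.continuousOn.integrableOn_compact (isCompact_closedBall x ε)).mono_set
      Metric.ball_subset_closedBall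
  have hir : IntegrableOn (bochnerRieszKernel d α) (Metric.ball 0 r) :=
    (hkc.continuousOn.integrableOn_compact (isCompact_closedBall 0 r)).mono_set
      Metric.ball_subset_closedBall
  have hiA : IntegrableOn (bochnerRieszKernel d α) A := hir.mono_set Set.sdiff_subset
  have e1 : ∫ x, bochnerRieszKernel d α x * symmRearr φ x =
      ∫ x in Metric.ball 0 r, bochnerRieszKernel d α x := by
    rw [← integral_indicator measurableSet_ball]
    refine integral_congr_ae ?_
    filter_upwards [hrearr] with x hx
    rw [hx, hχn]
    by_cases h1 : x ∈ Metric.ball 0 r <;> simp [h1]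
  have e2 : ∫ x, (bochnerRieszKernel d α x : ℂ) * φ x =
      (((∫ x in A, bochnerRieszKernel d α x) +
        l * ∫ x in Metric.ball s ε, bochnerRieszKernel d α x : ℝ) : ℂ) := by
    rw [← integral_const_mul, ← integral_indicator hAm, ← integral_indicator hBm,
      ← integral_add ((integrable_indicator_iff hAm).2 hiA)
        ((integrable_indicator_iff hBm).2 ((hiball s).const_mul l)), ← integral_complex_ofReal]
    refine integral_congr_ae (ae_of_all _ fun x => ?_)
    by_cases h1 : x ∈ A <;> by_cases h2 : x ∈ Metric.ball s ε <;>
      simp [hφ, h1, h2, mul_add, mul_comm]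
  rw [e1, e2, Complex.norm_real] at main
  have main' := (le_abs_self _).trans main
  have e3 := setIntegral_sdiff (μ := volume) measurableSet_ball hir ht
  rw [← hA] at e3
  linarith

/-- If it failed, the levels `m₁ < m₂` would separate the kernel near `t` from its signed value near
`s`, against the test on balls of small radius `ε`. -/
theorem IsDonohoStarkConstant.abs_le_of_norm_lt (hd : 1 ≤ d) (hα : -1 < α) {ϑ : ℝ}
    (h : IsDonohoStarkConstant d α ϑ) {t s : EuclideanSpace ℝ (Fin d)} (hts : ‖t‖ < ‖s‖)
    (ht : ‖t‖ <
      ϑ / (volume (Metric.ball (0 : EuclideanSpace ℝ (Fin d)) 1)).toReal ^ (1 / (d : ℝ))) :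
    |bochnerRieszKernel d α s| ≤ bochnerRieszKernel d α t := by
  have hkc := continuous_bochnerRieszKernel hd hα
  by_contra! hlt
  obtain ⟨l, hl, hls⟩ : ∃ l : ℝ, |l| = 1 ∧
      l * bochnerRieszKernel d α s = |bochnerRieszKernel d α s| := by
    rcases le_total 0 (bochnerRieszKernel d α s) with h0 | h0
    · exact ⟨1, by simp, by rw [one_mul, abs_of_nonneg h0]⟩
    · exact ⟨-1, by simp, by rw [abs_of_nonpos h0]; ring⟩
  obtain ⟨r, htr, hr⟩ := exists_between (lt_min hts ht)
  rw [lt_min_iff, lt_div_iff₀ unitBall_rpow_pos] at hr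
  obtain ⟨m₁, hm₁, hm₁'⟩ := exists_between hlt
  obtain ⟨m₂, hm₂, hm₂'⟩ := exists_between hm₁'
  rw [← hls] at hm₂'
  have hkl : Continuous fun x => l * bochnerRieszKernel d α x := by fun_prop
  obtain ⟨ε₁, hε₁, h1⟩ := Metric.mem_nhds_iff.1 (hkc.continuousAt.eventually_lt_const hm₁)
  obtain ⟨ε₂, hε₂, h2⟩ := Metric.mem_nhds_iff.1 (hkl.continuousAt.eventually_const_lt hm₂')
  set ε := min (min ε₁ ε₂) (min (r - ‖t‖) (‖s‖ - r)) with hε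
  have hε0 : 0 < ε := lt_min (lt_min hε₁ hε₂) (lt_min (by linarith) (by linarith [hr.1]))
  have hεt : ε ≤ r - ‖t‖ := (min_le_right _ _).trans (min_le_left _ _)
  have hεs : ε ≤ ‖s‖ - r := (min_le_right _ _).trans (min_le_right _ _)
  have key := h.setIntegral_le hd hα (t := t) (s := s) (r := r) (ε := ε) (l := l)
    ((norm_nonneg _).trans_lt htr) hr.2.le
    (Metric.ball_subset_ball' (by rw [dist_zero_right]; linarith))
    (Metric.ball_disjoint_ball (by rw [dist_zero_right]; linarith)) hl
  have hi : ∀ x, ∀ {g : EuclideanSpace ℝ (Fin d) → ℝ}, Continuous g →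
      IntegrableOn g (Metric.ball x ε) := fun x g hg =>
    (hg.continuousOn.integrableOn_compact (isCompact_closedBall x ε)).mono_set
      Metric.ball_subset_closedBall
  have b1 : ∫ x in Metric.ball t ε, bochnerRieszKernel d α x ≤ ∫ x in Metric.ball t ε, m₁ :=
    setIntegral_mono_on (hi t hkc) (hi t continuous_const) measurableSet_ball fun x hx =>
      (h1 (Metric.ball_subset_ball ((min_le_left _ _).trans (min_le_left _ _)) hx)).le
  have b2 : ∫ x in Metric.ball s ε, m₂ ≤ ∫ x in Metric.ball s ε, l * bochnerRieszKernel d α x :=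
    setIntegral_mono_on (hi s continuous_const) (hi s hkl) measurableSet_ball fun x hx =>
      (h2 (Metric.ball_subset_ball ((min_le_left _ _).trans (min_le_right _ _)) hx)).le
  have hv : volume.real (Metric.ball s ε) = volume.real (Metric.ball t ε) := by
    rw [Measure.real, Measure.real, Measure.addHaar_ball_center volume s,
      Measure.addHaar_ball_center volume t]
  have hv0 : 0 < volume.real (Metric.ball t ε) :=
    ENNReal.toReal_pos (Metric.measure_ball_pos _ _ hε0).ne' measure_ball_lt_top.ne
  rw [integral_const_mul, setIntegral_const, hv, smul_eq_mul] at b2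
  rw [setIntegral_const, smul_eq_mul] at b1
  have := mul_lt_mul_of_pos_left hm₂ hv0
  linarith

/-- The equality cases follow by continuity, pushing `s` outwards and `t` inwards; only `s = 0`
cannot be pushed. -/
theorem IsDonohoStarkConstant.radiallyDominant (hd : 1 ≤ d) (hα : -1 < α) {ϑ : ℝ}
    (h : IsDonohoStarkConstant d α ϑ) :
    RadiallyDominant (bochnerRieszKernel d α)
      (ϑ / (volume (Metric.ball (0 : EuclideanSpace ℝ (Fin d)) 1)).toReal ^ (1 / (d : ℝ))) := by
  intro t s hts ht
  have hkc := continuous_bochnerRieszKernel hd hα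
  have hρ : 0 < ϑ /
      (volume (Metric.ball (0 : EuclideanSpace ℝ (Fin d)) 1)).toReal ^ (1 / (d : ℝ)) :=
    div_pos h.1 unitBall_rpow_pos
  rcases eq_or_ne s 0 with rfl | hs
  · have : t = 0 := by simpa using hts
    rw [this, abs_of_pos (bochnerRieszKernel_zero_pos hd hα)]
  have hs' : 0 < ‖s‖ := norm_pos_iff.2 hs
  have c1 : Continuous fun η : ℝ => |bochnerRieszKernel d α ((1 + η) • s)| := by fun_prop
  have c2 : Continuous fun η : ℝ => bochnerRieszKernel d α ((1 - η) • t) := by fun_prop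
  have l1 := (c1.tendsto 0).mono_left (nhdsWithin_le_nhds (s := Set.Ioi 0))
  have l2 := (c2.tendsto 0).mono_left (nhdsWithin_le_nhds (s := Set.Ioi 0))
  simp only [add_zero, sub_zero, one_smul] at l1 l2
  refine le_of_tendsto_of_tendsto l1 l2 ?_
  filter_upwards [Ioo_mem_nhdsGT (zero_lt_one' ℝ)] with η hη
  have n1 : ‖(1 + η) • s‖ = (1 + η) * ‖s‖ := by
    rw [norm_smul, Real.norm_of_nonneg (by linarith [hη.1])]
  have n2 : ‖(1 - η) • t‖ = (1 - η) * ‖t‖ := by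
    rw [norm_smul, Real.norm_of_nonneg (by linarith [hη.2])]
  refine h.abs_le_of_norm_lt hd hα ?_ ?_
  · rw [n1, n2]
    nlinarith [mul_nonneg hη.1.le (norm_nonneg t), mul_pos hη.1 hs']
  · rw [n2]
    nlinarith [mul_pos hη.1 hρ, mul_le_mul_of_nonneg_left ht (sub_nonneg.2 hη.2.le)]

end Constants

/-! ### The quadratic inequality. -/

theorem integrable_of_memLp_two_of_volume_support_ne_top {d : ℕ}
    {φ : EuclideanSpace ℝ (Fin d) → ℂ} (hφ : MemLp φ 2)
    (hs : volume (Function.support φ) ≠ ∞) : Integrable φ := by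
  have : IsFiniteMeasure (volume.restrict (Function.support φ)) :=
    ⟨by rw [Measure.restrict_apply_univ]; exact hs.lt_top⟩
  rw [← integrableOn_iff_integrable_of_support_subset subset_rfl]
  exact (hφ.restrict _).integrable (by norm_num)

/-- Constants for the `L¹` inequality exist, and every such constant `ϑ` gives the quadratic
inequality for all `φ ∈ L²` with support of finite measure `S` and `Ω S^{1/d} ≤ ϑ / 2`.
Such `φ` and `|φ|^*` lie in `L¹ ∩ L²`, where the Fourier transform is the Fourier integral `𝓕`. -/
theorem mainTheorem9 (d : ℕ) (hd : 1 ≤ d) (α : ℝ) (hα : -1 / 2 < α) :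
    (∃ ϑ : ℝ, IsDonohoStarkConstant d α ϑ) ∧
    ∀ ϑ : ℝ, IsDonohoStarkConstant d α ϑ →
    ∀ Ω : ℝ, 0 < Ω →
    ∀ φ : EuclideanSpace ℝ (Fin d) → ℂ, MemLp φ 2 →
      volume (Function.support φ) ≠ ⊤ →
      Ω * (volume (Function.support φ)).toReal ^ (1 / (d : ℝ)) ≤ ϑ / 2 →
      Integrable (symmRearr φ) ∧
      Integrable (fun ξ => bochnerRieszWeight d α Ω ξ * ‖𝓕 φ ξ‖ ^ 2) ∧
      Integrable (fun ξ => bochnerRieszWeight d α Ω ξ *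
        ‖𝓕 (fun x => (symmRearr φ x : ℂ)) ξ‖ ^ 2) ∧
      |∫ ξ, bochnerRieszWeight d α Ω ξ * ‖𝓕 φ ξ‖ ^ 2| ≤
        ∫ ξ, bochnerRieszWeight d α Ω ξ * ‖𝓕 (fun x => (symmRearr φ x : ℂ)) ξ‖ ^ 2 := by
  have hα' : -1 < α := by linarith
  constructor
  · obtain ⟨ρ, hρ, h⟩ := exists_radiallyDominant_bochnerRieszKernel hd hα'
    exact ⟨_, h.isDonohoStarkConstant hd hα' hρ⟩
  intro ϑ hϑ Ω hΩ φ hφ2 hsupp hΩS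
  have hφ := integrable_of_memLp_two_of_volume_support_ne_top hφ2 hsupp
  have hφs := integrable_symmRearr hd hφ
  have hφc : Integrable fun x => (symmRearr φ x : ℂ) := hφs.ofReal
  refine ⟨hφs, integrable_bochnerRieszWeight_mul_fourier_sq hd hα' hΩ hφ,
    integrable_bochnerRieszWeight_mul_fourier_sq hd hα' hΩ hφc, ?_⟩
  have hω := unitBall_rpow_pos (d := d)
  obtain ⟨ψ, hψc, hψa, hψ0, hkψ, hψk⟩ := (hϑ.radiallyDominant hd hα').exists_majorant hd
    (div_pos hϑ.1 hω).le (continuous_bochnerRieszKernel hd hα')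
  have hψΩ : Continuous fun x => ψ (Ω • x) := by fun_prop
  have hψΩa := hψa.comp_smul Ω
  have hψΩ0 : 0 ≤ fun x => ψ (Ω • x) := fun x => hψ0 (Ω • x)
  -- The factor `2`, paid for by `ϑ / 2`, allows for differences of two points of the ball carrying
  -- `|φ|^*`.
  have hR : 2 * (Ω * symmRearrRadius (Function.support φ)) ≤
      ϑ / (volume (Metric.ball (0 : EuclideanSpace ℝ (Fin d)) 1)).toReal ^ (1 / (d : ℝ)) := by
    rw [symmRearrRadius_eq_div, ← mul_div_assoc, ← mul_div_assoc]
    gcongr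
    linarith
  calc |∫ ξ, bochnerRieszWeight d α Ω ξ * ‖𝓕 φ ξ‖ ^ 2|
      ≤ rieszEnergy (fun x => ψ (Ω • x)) (fun x => ‖φ x‖) := by
        rw [← Real.norm_eq_abs, ← Complex.norm_real,
          integral_bochnerRieszWeight_mul_fourier_sq hd hα' hΩ hφ]
        refine norm_integral_le_of_norm_le
          (integrable_rieszEnergy hψΩa hψΩ0 hψΩ hφ.norm hφ.norm) (ae_of_all _ fun p => ?_)
        rw [norm_mul, norm_mul, Complex.norm_real, RCLike.norm_conj]
        gcongr
        exact hkψ _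
    _ ≤ rieszEnergy (fun x => ψ (Ω • x)) (symmRearr φ) :=
        rieszEnergy_le_symmRearr hd hψΩa hψΩ0 hψΩ hφ
    _ = _ := by
        rw [← Complex.ofReal_inj, integral_bochnerRieszWeight_mul_fourier_sq hd hα' hΩ hφc,
          rieszEnergy, ← integral_complex_ofReal]
        refine integral_congr_ae (ae_of_all _ fun p => ?_)
        dsimp only
        rw [Complex.conj_ofReal]
        push_cast
        -- If either point is outside that ball both integrands vanish; otherwise `Ω • (p.1 - p.2)`
        -- is within the radius where `ψ` equals the kernel.
        rcases le_or_gt (symmRearrRadius (Function.support φ)) ‖p.1‖ with h1 | h1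
        · simp [symmRearr_eq_zero hsupp h1]
        rcases le_or_gt (symmRearrRadius (Function.support φ)) ‖p.2‖ with h2 | h2
        · simp [symmRearr_eq_zero hsupp h2]
        rw [hψk]
        refine le_trans ?_ hR
        rw [norm_smul, Real.norm_of_nonneg hΩ.le]
        have := norm_sub_le p.1 p.2
        nlinarith
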